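/- Let $(M,g,J)$ be a Kähler manifold of indefinite metric, of real dimension $2n$ and signature $(2s,2(n-s))$ ($2s$ minus signs, $2(n-s)$ plus signs): $g$ is a smooth pseudo-Riemannian metric of this signature, $J$ is a smooth almost complex structure with $J^2=-\mathrm{id}$, $g(JX,JY)=g(X,Y)$, and $\nabla J=0$ for the Levi-Civita connection $\nabla$ of $g$. Assume $s\ge 2$ and $n-s\ge 2$. A 2-dimensional subspace $E\subset T_pM$ is called an isotropic holomorphic 2-plane if $JE=E$ and the restriction of $g$ to $E$ is degenerate (it is then identically zero). Suppose that $M$ satisfies the axiom of isotropic holomorphic 2-planes: for each point $p\in M$ and each isotropic holomorphic 2-plane $E\subset T_pM$ there is a totally geodesic submanifold $M'$ of $M$ containing $p$ such that $T_pM'=E$ and all the tangent spaces of $M'$ are isotropic holomorphic 2-planes. (Totally geodesic means that $\nabla_XY$ is tangent to $M'$ whenever $X,Y$ are tangent to $M'$.) Then the Bochner curvature tensor $B(R)$ of $M$ vanishes identically. Here $R(x,y,z,u)=g(R(x,y)z,u)$ with $R(X,Y)=[\nabla_X,\nabla_Y]-\nabla_{[X,Y]}$, and for a tensor $T$ of type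 $(0,4)$ and an orthonormal basis $\{e_i\}$ of $T_pM$ one puts $\overline T(x,y,z,u)=T(Jx,Jy,Jz,Ju)$, $$\rho(T)(y,z)=\sum_i g(e_i,e_i)T(e_i,y,z,e_i),\qquad \rho^*(T)(y,z)=\sum_i g(e_i,e_i)T(e_i,y,Jz,Je_i),$$ $\tau(T)=\sum_i g(e_i,e_i)\rho(T)(e_i,e_i)$, $\tau^*(T)=\sum_i g(e_i,e_i)\rho^*(T)(e_i,e_i)$. For a tensor $S$ of type $(0,2)$, $$\varphi(S)(x,y,z,u)=g(y,z)S(x,u)-g(x,z)S(y,u)+g(x,u)S(y,z)-g(y,u)S(x,z),$$ $$\psi(S)(x,y,z,u)=g(y,Jz)S(x,Ju)-g(x,Jz)S(y,Ju)-2g(x,Jy)S(z,Ju)+g(x,Ju)S(y,Jz)-g(y,Ju)S(x,Jz)-2g(z,Ju)S(x,Jy),$$ $\pi_1=\tfrac12\varphi(g)$, $\pi_2=\tfrac12\psi(g)$, and $$B(R)=R-\frac{(\varphi+\psi)\big((\rho+3\rho^*)(R+\overline R)\big)}{16(n+2)}-\frac{(3\varphi-\psi)\big((\rho-\rho^*)(R+\overline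 R)\big)}{16(n-2)}-\frac{\psi\big(\rho^*(R-\overline R)\big)}{4(n+1)}-\frac{\varphi\big(\rho(R-\overline R)\big)}{4(n-1)}$$ $$+\frac{(\tau+3\tau^*)(R)}{16(n+1)(n+2)}(\pi_1+\pi_2)+\frac{(\tau-\tau^*)(R)}{16(n-1)(n-2)}(3\pi_1-\pi_2).$$ -/

import Mathlib

open scoped Manifold ContDiff Topology
open Bundle

noncomputable section

/-! ### Pseudo-Riemannian and almost Hermitian structures

`M` is a smooth manifold without boundary modelled on the real vector space `E`, and a vector field
is a function `X : Π q : M, TangentSpace 𝓘(ℝ, E) q`. -/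

namespace IndefKaehler

section Fields

variable {E : Type*} [NormedAddCommGroup E] [NormedSpace ℝ E]
  {M : Type*} [TopologicalSpace M] [ChartedSpace E M] [IsManifold 𝓘(ℝ, E) ∞ M]

/-- The vector field `X` is of class `C^∞` at `x`. -/
def SmoothFieldAt (X : Π q : M, TangentSpace 𝓘(ℝ, E) q) (x : M) : Prop :=
  ContMDiffAt 𝓘(ℝ, E) (𝓘(ℝ, E).prod 𝓘(ℝ, E)) ∞
    (fun q ↦ (TotalSpace.mk' E q (X q) : TangentBundle 𝓘(ℝ, E) M)) x

/-- The vector field `X` is differentiable at `x`. -/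
def DiffFieldAt (X : Π q : M, TangentSpace 𝓘(ℝ, E) q) (x : M) : Prop :=
  MDifferentiableAt 𝓘(ℝ, E) (𝓘(ℝ, E).prod 𝓘(ℝ, E))
    (fun q ↦ (TotalSpace.mk' E q (X q) : TangentBundle 𝓘(ℝ, E) M)) x

end Fields

section Structures

variable (E : Type*) [NormedAddCommGroup E] [NormedSpace ℝ E]
  (M : Type*) [TopologicalSpace M] [ChartedSpace E M] [IsManifold 𝓘(ℝ, E) ∞ M]

/-- A pseudo-Riemannian metric: a smooth field of nondegenerate symmetric bilinear forms on the
tangent spaces. -/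
structure PseudoMetric where
  /-- the bilinear form on each tangent space -/
  form (p : M) : TangentSpace 𝓘(ℝ, E) p →L[ℝ] TangentSpace 𝓘(ℝ, E) p →L[ℝ] ℝ
  symm (p : M) (v w : TangentSpace 𝓘(ℝ, E) p) : form p v w = form p w v
  nondegenerate (p : M) (v : TangentSpace 𝓘(ℝ, E) p) (hv : ∀ w, form p v w = 0) : v = 0
  contMDiff : ContMDiff 𝓘(ℝ, E) (𝓘(ℝ, E).prod 𝓘(ℝ, E →L[ℝ] E →L[ℝ] ℝ)) ∞
    (fun p ↦ TotalSpace.mk' (E →L[ℝ] E →L[ℝ] ℝ)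
      (E := fun q : M ↦ TangentSpace 𝓘(ℝ, E) q →L[ℝ] TangentSpace 𝓘(ℝ, E) q →L[ℝ] ℝ) p (form p))

/-- An almost Hermitian structure `(g, J)`, the metric `g` being allowed to be indefinite: `J` is a
smooth field of endomorphisms of the tangent spaces with `J² = -1` and `g(Jv, Jw) = g(v, w)`. -/
structure AlmostHermitian where
  /-- the metric -/
  g : PseudoMetric E M
  /-- the almost complex structure -/
  J (p : M) : TangentSpace 𝓘(ℝ, E) p →L[ℝ] TangentSpace 𝓘(ℝ, E) p
  J_sq (p : M) (v : TangentSpace 𝓘(ℝ, E) p) : J p (J p v) = -v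
  compat (p : M) (v w : TangentSpace 𝓘(ℝ, E) p) : g.form p (J p v) (J p w) = g.form p v w
  contMDiff_J : ContMDiff 𝓘(ℝ, E) (𝓘(ℝ, E).prod 𝓘(ℝ, E →L[ℝ] E)) ∞
    (fun p ↦ TotalSpace.mk' (E →L[ℝ] E)
      (E := fun q : M ↦ TangentSpace 𝓘(ℝ, E) q →L[ℝ] TangentSpace 𝓘(ℝ, E) q) p (J p))

end Structures

variable {E : Type*} [NormedAddCommGroup E] [NormedSpace ℝ E]
  {M : Type*} [TopologicalSpace M] [ChartedSpace E M] [IsManifold 𝓘(ℝ, E) ∞ M]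

/-- The basis `e` of `T_pM` is orthonormal: `g(e_i, e_i) = ±1` and `g(e_i, e_j) = 0` for
`i ≠ j`. -/
def PseudoMetric.IsOrthonormalBasis (g : PseudoMetric E M) (p : M) {ι : Type*}
    (e : Module.Basis ι ℝ (TangentSpace 𝓘(ℝ, E) p)) : Prop :=
  (∀ i, g.form p (e i) (e i) = 1 ∨ g.form p (e i) (e i) = -1) ∧
    ∀ i j, i ≠ j → g.form p (e i) (e j) = 0

/-- `g` has signature `(a, b)`: each tangent space has an orthonormal basis consisting of `a`
vectors with `g(e, e) = -1` and `b` vectors with `g(e, e) = 1`. -/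
def PseudoMetric.HasSignature (g : PseudoMetric E M) (a b : ℕ) : Prop :=
  ∀ p : M, ∃ e : Module.Basis (Fin a ⊕ Fin b) ℝ (TangentSpace 𝓘(ℝ, E) p),
    g.IsOrthonormalBasis p e ∧
    (∀ i, g.form p (e (Sum.inl i)) (e (Sum.inl i)) = -1) ∧
    ∀ j, g.form p (e (Sum.inr j)) (e (Sum.inr j)) = 1

/-! ### Levi-Civita connection, Kähler condition, curvature

For a covariant derivative `nabla` on the tangent bundle, `nabla Y x v` is `(∇_v Y)(x)`. -/

/-- `nabla` is the Levi-Civita connection of `g`: the smooth linear connection that is torsion-free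
and satisfies `∇g = 0`. -/
structure IsLeviCivita (g : PseudoMetric E M)
    (nabla : CovariantDerivative 𝓘(ℝ, E) E (TangentSpace 𝓘(ℝ, E) : M → Type _)) : Prop where
  smooth (U : Set M) (hU : IsOpen U) : ContMDiffCovariantDerivativeOn E ∞ nabla U
  torsion_free (X Y : Π q : M, TangentSpace 𝓘(ℝ, E) q) (x : M)
    (hX : DiffFieldAt X x) (hY : DiffFieldAt Y x) :
    nabla Y x (X x) - nabla X x (Y x) = VectorField.mlieBracket 𝓘(ℝ, E) X Y x
  metric (Y Z : Π q : M, TangentSpace 𝓘(ℝ, E) q) (x : M)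
    (hY : DiffFieldAt Y x) (hZ : DiffFieldAt Z x) (v : TangentSpace 𝓘(ℝ, E) x) :
    mvfderiv 𝓘(ℝ, E) (fun q ↦ g.form q (Y q) (Z q)) x v =
      g.form x (nabla Y x v) (Z x) + g.form x (Y x) (nabla Z x v)

/-- `(M, g, J)` is a Kähler manifold with Levi-Civita connection `nabla`: `∇J = 0`, that is,
`∇_v(JY) = J ∇_v Y`. -/
structure IsKaehler (h : AlmostHermitian E M)
    (nabla : CovariantDerivative 𝓘(ℝ, E) E (TangentSpace 𝓘(ℝ, E) : M → Type _)) : Prop where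
  leviCivita : IsLeviCivita h.g nabla
  parallel_J (Y : Π q : M, TangentSpace 𝓘(ℝ, E) q) (x : M) (hY : DiffFieldAt Y x)
    (v : TangentSpace 𝓘(ℝ, E) x) :
    nabla (fun q ↦ h.J q (Y q)) x v = h.J x (nabla Y x v)

/-- The curvature operator `R(x, y)z = (∇_X ∇_Y Z - ∇_Y ∇_X Z - ∇_{[X, Y]} Z)(p)`, where `X`, `Y`,
`Z` are the vector fields with values `x`, `y`, `z` at `p` that have constant coordinates in the
preferred trivialization of the tangent bundle at `p`; they are smooth near `p`. -/
def curvature (nabla : CovariantDerivative 𝓘(ℝ, E) E (TangentSpace 𝓘(ℝ, E) : M → Type _)) (p : M)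
    (x y z : TangentSpace 𝓘(ℝ, E) p) : TangentSpace 𝓘(ℝ, E) p :=
  let X : Π q : M, TangentSpace 𝓘(ℝ, E) q := FiberBundle.extend E x
  let Y : Π q : M, TangentSpace 𝓘(ℝ, E) q := FiberBundle.extend E y
  let Z : Π q : M, TangentSpace 𝓘(ℝ, E) q := FiberBundle.extend E z
  nabla (fun q ↦ nabla Z q (Y q)) p x - nabla (fun q ↦ nabla Z q (X q)) p y
    - nabla Z p (VectorField.mlieBracket 𝓘(ℝ, E) X Y p)

/-- The curvature tensor of type (0,4), `R(x, y, z, u) = g(R(x, y)z, u)`. -/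
def curvatureTensor (g : PseudoMetric E M)
    (nabla : CovariantDerivative 𝓘(ℝ, E) E (TangentSpace 𝓘(ℝ, E) : M → Type _)) (p : M)
    (x y z u : TangentSpace 𝓘(ℝ, E) p) : ℝ :=
  g.form p (curvature nabla p x y z) u

/-! ### The Bochner tensor

Pointwise algebra on a real vector space `V` with a bilinear form `g` and an endomorphism `J`.
Traces are taken with respect to an orthonormal basis `e`. -/

section Bochner

variable {V : Type*} [AddCommGroup V] [Module ℝ V] {ι : Type*} [Fintype ι]

/-- `ρ(T)(y, z) = ∑ g(e_i, e_i) T(e_i, y, z, e_i)` -/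
def ricci (g : V → V → ℝ) (e : Module.Basis ι ℝ V) (T : V → V → V → V → ℝ) (y z : V) : ℝ :=
  ∑ i, g (e i) (e i) * T (e i) y z (e i)

/-- `ρ*(T)(y, z) = ∑ g(e_i, e_i) T(e_i, y, Jz, Je_i)` -/
def ricciStar (g : V → V → ℝ) (J : V → V) (e : Module.Basis ι ℝ V) (T : V → V → V → V → ℝ)
    (y z : V) : ℝ :=
  ∑ i, g (e i) (e i) * T (e i) y (J z) (J (e i))

/-- The trace `∑ g(e_i, e_i) S(e_i, e_i)`; it gives `τ` from `ρ` and `τ*` from `ρ*`. -/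
def trace (g : V → V → ℝ) (e : Module.Basis ι ℝ V) (S : V → V → ℝ) : ℝ :=
  ∑ i, g (e i) (e i) * S (e i) (e i)

/-- The tensor `φ(S)`. -/
def phi (g : V → V → ℝ) (S : V → V → ℝ) (x y z u : V) : ℝ :=
  g y z * S x u - g x z * S y u + g x u * S y z - g y u * S x z

/-- The tensor `ψ(S)`. -/
def psi (g : V → V → ℝ) (J : V → V) (S : V → V → ℝ) (x y z u : V) : ℝ :=
  g y (J z) * S x (J u) - g x (J z) * S y (J u) - 2 * g x (J y) * S z (J u)
    + g x (J u) * S y (J z) - g y (J u) * S x (J z) - 2 * g z (J u) * S x (J y)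

/-- The tensor `π₁`. -/
def pi₁ (g : V → V → ℝ) (x y z u : V) : ℝ :=
  g y z * g x u - g x z * g y u

/-- The tensor `π₂`. -/
def pi₂ (g : V → V → ℝ) (J : V → V) (x y z u : V) : ℝ :=
  g y (J z) * g x (J u) - g x (J z) * g y (J u) - 2 * g x (J y) * g z (J u)

/-- The Bochner tensor `B(R)` of a curvature tensor `R` in complex dimension `n`, for an arbitrary
almost Hermitian structure; `Rbar(x, y, z, u) = R(Jx, Jy, Jz, Ju)`. -/
def bochner (n : ℕ) (g : V → V → ℝ) (J : V → V) (e : Module.Basis ι ℝ V)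
    (R : V → V → V → V → ℝ) (x y z u : V) : ℝ :=
  let Rbar : V → V → V → V → ℝ := fun x y z u ↦ R (J x) (J y) (J z) (J u)
  let P : V → V → V → V → ℝ := fun x y z u ↦ R x y z u + Rbar x y z u
  let Q : V → V → V → V → ℝ := fun x y z u ↦ R x y z u - Rbar x y z u
  let S₁ : V → V → ℝ := fun y z ↦ ricci g e P y z + 3 * ricciStar g J e P y z
  let S₂ : V → V → ℝ := fun y z ↦ ricci g e P y z - ricciStar g J e P y z
  let τ : ℝ := trace g e (ricci g e R)
  let τs : ℝ := trace g e (ricciStar g J e R)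
  R x y z u
    - 1 / (16 * ((n : ℝ) + 2)) * (phi g S₁ x y z u + psi g J S₁ x y z u)
    - 1 / (16 * ((n : ℝ) - 2)) * (3 * phi g S₂ x y z u - psi g J S₂ x y z u)
    - 1 / (4 * ((n : ℝ) + 1)) * psi g J (ricciStar g J e Q) x y z u
    - 1 / (4 * ((n : ℝ) - 1)) * phi g (ricci g e Q) x y z u
    + 1 / (16 * ((n : ℝ) + 1) * ((n : ℝ) + 2)) * (τ + 3 * τs)
        * (pi₁ g x y z u + pi₂ g J x y z u)
    + 1 / (16 * ((n : ℝ) - 1) * ((n : ℝ) - 2)) * (τ - τs)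
        * (3 * pi₁ g x y z u - pi₂ g J x y z u)

end Bochner

/-- The Bochner curvature tensor of `(M, g, J)`, of real dimension `2n`, vanishes. -/
def BochnerVanishes (n : ℕ) (h : AlmostHermitian E M)
    (nabla : CovariantDerivative 𝓘(ℝ, E) E (TangentSpace 𝓘(ℝ, E) : M → Type _)) : Prop :=
  ∀ (p : M) (e : Module.Basis (Fin (2 * n)) ℝ (TangentSpace 𝓘(ℝ, E) p)),
    h.g.IsOrthonormalBasis p e → ∀ x y z u : TangentSpace 𝓘(ℝ, E) p,
      bochner n (fun v w ↦ h.g.form p v w) (fun v ↦ h.J p v) e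
        (curvatureTensor h.g nabla p) x y z u = 0

/-! ### The axiom of isotropic holomorphic 2-planes -/

/-- `P` is an isotropic holomorphic 2-plane in `T_pM`: `dim P = 2`, `JP = P`, and the restriction of
`g` to `P` is degenerate (of rank 1 or 0). -/
def IsIsotropicHolomorphicPlane (h : AlmostHermitian E M) (p : M)
    (P : Submodule ℝ (TangentSpace 𝓘(ℝ, E) p)) : Prop :=
  Module.finrank ℝ P = 2 ∧ P.map (h.J p).toLinearMap = P ∧
    ∃ v ∈ P, v ≠ 0 ∧ ∀ w ∈ P, h.g.form p v w = 0

section Submanifolds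

variable {N : Type*} [TopologicalSpace N] [ChartedSpace (EuclideanSpace ℝ (Fin 2)) N]

/-- The tangent space at `f a` of the surface `f : N → M`, as a subspace of `T_{f a}M`. -/
def tangentPlane (f : N → M) (a : N) : Submodule ℝ (TangentSpace 𝓘(ℝ, E) (f a)) :=
  LinearMap.range (mfderiv (𝓡 2) 𝓘(ℝ, E) f a).toLinearMap

/-- The immersed surface `f : N → M` is totally geodesic: `∇_X Y` is tangent to it whenever the
local vector fields `X`, `Y` of `M` are tangent to it. -/
def IsTotallyGeodesic
    (nabla : CovariantDerivative 𝓘(ℝ, E) E (TangentSpace 𝓘(ℝ, E) : M → Type _)) (f : N → M) :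
    Prop :=
  ∀ (a : N) (X Y : Π q : M, TangentSpace 𝓘(ℝ, E) q),
    SmoothFieldAt X (f a) → SmoothFieldAt Y (f a) →
    (∀ᶠ b in 𝓝 a, X (f b) ∈ tangentPlane f b) → (∀ᶠ b in 𝓝 a, Y (f b) ∈ tangentPlane f b) →
    nabla Y (f a) (X (f a)) ∈ tangentPlane f a

end Submanifolds

/-- The axiom of isotropic holomorphic 2-planes: for each point `p` and each isotropic holomorphic
2-plane `P` in `T_pM` there is a totally geodesic (injectively immersed) submanifold through `p`
with tangent space `P` at `p`, all of whose tangent spaces are isotropic holomorphic 2-planes. -/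
def AxiomOfIsotropicHolomorphicPlanes (h : AlmostHermitian E M)
    (nabla : CovariantDerivative 𝓘(ℝ, E) E (TangentSpace 𝓘(ℝ, E) : M → Type _)) : Prop :=
  ∀ (p : M) (P : Submodule ℝ (TangentSpace 𝓘(ℝ, E) p)), IsIsotropicHolomorphicPlane h p P →
    ∃ (N : Type) (_ : TopologicalSpace N) (_ : ChartedSpace (EuclideanSpace ℝ (Fin 2)) N)
      (_ : IsManifold (𝓡 2) ∞ N) (f : N → M) (a : N) (ha : f a = p),
      Manifold.IsImmersion (𝓡 2) 𝓘(ℝ, E) ∞ f ∧ Function.Injective f ∧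
      ha ▸ tangentPlane f a = P ∧
      (∀ b, IsIsotropicHolomorphicPlane h (f b) (tangentPlane f b)) ∧
      IsTotallyGeodesic nabla f

end IndefKaehler

end

/-! Everything rests on the quartic form H(v) = R(v, Jv, Jv, v). If v ≠ 0 is isotropic, then span{v,
Jv} is an isotropic holomorphic plane. The totally geodesic surface tangent to it forces R(v, Jv)Jv
to lie in that plane, which is orthogonal to v, so H(v) = 0 (`curvatureTensor_isotropic`).

A quartic that vanishes on the null cone of an indefinite quadratic form is divisible by that form:
H(v) = g(v, v) S(v, v), where S can be made J-invariant by averaging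
(`IsKaehlerTensor.exists_factor`).

The tensor (φ + ψ)(S/8) has the symmetries of a Kähler curvature tensor and the same H. Such tensors
are determined by H (`eq_zero_of_holomorphic`), so R = (φ + ψ)(S/8). Taking traces shows that every
tensor of this shape has zero Bochner tensor (`bochner_phi_add_psi`).

The differential-geometric half supplies the symmetries of R from the Levi-Civita and Kähler
conditions, and the invariance of tangent planes of totally geodesic surfaces under R. -/

noncomputable section

namespace IndefKaehler

/-! ### Fields and functions smooth near a point -/

section Smooth

set_option linter.unusedSectionVars false

variable {E : Type*} [NormedAddCommGroup E] [NormedSpace ℝ E]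
  {M : Type*} [TopologicalSpace M] [ChartedSpace E M] [IsManifold 𝓘(ℝ, E) ∞ M]

/-- The vector field `X` is smooth on a neighbourhood of `p`. -/
def SmoothNear (X : Π q : M, TangentSpace 𝓘(ℝ, E) q) (p : M) : Prop :=
  ∀ᶠ q in 𝓝 p, SmoothFieldAt X q

/-- The function `f` is smooth on a neighbourhood of `p`. -/
def SmoothFunNear (f : M → ℝ) (p : M) : Prop :=
  ∀ᶠ q in 𝓝 p, ContMDiffAt 𝓘(ℝ, E) 𝓘(ℝ) ∞ f q

variable {X Y Z : Π q : M, TangentSpace 𝓘(ℝ, E) q} {f : M → ℝ} {p : M}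

lemma SmoothFieldAt.diff (h : SmoothFieldAt X p) : DiffFieldAt X p :=
  ContMDiffAt.mdifferentiableAt h (by simp)

lemma SmoothNear.smooth (h : SmoothNear X p) : SmoothFieldAt X p := h.self_of_nhds

lemma SmoothNear.diff (h : SmoothNear X p) : DiffFieldAt X p := h.smooth.diff

lemma SmoothNear.near (h : SmoothNear X p) : ∀ᶠ q in 𝓝 p, SmoothNear X q :=
  eventually_eventually_nhds.2 h

lemma SmoothFunNear.smooth (h : SmoothFunNear (E := E) f p) :
    ContMDiffAt 𝓘(ℝ, E) 𝓘(ℝ) ∞ f p := h.self_of_nhds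

lemma SmoothFunNear.diff (h : SmoothFunNear (E := E) f p) :
    MDifferentiableAt 𝓘(ℝ, E) 𝓘(ℝ) f p := h.smooth.mdifferentiableAt (by simp)

lemma SmoothFunNear.near (h : SmoothFunNear (E := E) f p) :
    ∀ᶠ q in 𝓝 p, SmoothFunNear (E := E) f q :=
  eventually_eventually_nhds.2 h

lemma SmoothNear.congr (h : SmoothNear X p) (hXY : ∀ᶠ q in 𝓝 p, Y q = X q) : SmoothNear Y p := by
  filter_upwards [h, eventually_eventually_nhds.2 hXY] with q hq hq'
  exact ContMDiffAt.congr_of_eventuallyEq hq (hq'.mono fun r hr ↦ by simp [hr])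

lemma SmoothNear.add (hX : SmoothNear X p) (hY : SmoothNear Y p) : SmoothNear (X + Y) p := by
  filter_upwards [hX, hY] with q h1 h2
  exact ContMDiffAt.add_section h1 h2

lemma SmoothNear.smul (hf : SmoothFunNear (E := E) f p) (hX : SmoothNear X p) :
    SmoothNear (f • X) p := by
  filter_upwards [hf, hX] with q h1 h2
  exact ContMDiffAt.smul_section h1 h2

lemma SmoothNear.sum {ι : Type*} {s : Finset ι} {X : ι → Π q : M, TangentSpace 𝓘(ℝ, E) q}
    (hX : ∀ i ∈ s, SmoothNear (X i) p) : SmoothNear (fun q ↦ ∑ i ∈ s, X i q) p := by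
  have := (Filter.eventually_all_finset s).2 hX
  filter_upwards [this] with q hq
  exact ContMDiffAt.sum_section hq

lemma smoothNear_zero : SmoothNear (0 : Π q : M, TangentSpace 𝓘(ℝ, E) q) p :=
  Filter.Eventually.of_forall fun _ ↦ (contMDiff_zeroSection ℝ _).contMDiffAt

lemma smoothFunNear_const (c : ℝ) : SmoothFunNear (E := E) (fun _ : M ↦ c) p :=
  Filter.Eventually.of_forall fun _ ↦ contMDiffAt_const

lemma SmoothNear.extend (v : TangentSpace 𝓘(ℝ, E) p) :
    SmoothNear (FiberBundle.extend E v) p := by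
  obtain ⟨t, ht, h⟩ := FiberBundle.exists_contMDiffOn_extend (I := 𝓘(ℝ, E)) (k := ∞) E v
  obtain ⟨u, hut, huo, hpu⟩ := mem_nhds_iff.1 ht
  filter_upwards [huo.mem_nhds hpu] with q hq
  exact h.contMDiffAt (Filter.mem_of_superset (huo.mem_nhds hq) hut)

lemma SmoothNear.mvfderiv (hf : SmoothFunNear (E := E) f p) (hX : SmoothNear X p) :
    SmoothFunNear (E := E) (fun q ↦ mvfderiv 𝓘(ℝ, E) f q (X q)) p := by
  filter_upwards [hf, hX] with q h1 h2
  have h3 := ContMDiffAt.clm_apply_of_inCoordinates (b₁ := id) (b₂ := f)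
    (h1.mfderiv_const (m := ∞) (by simp)) h2 h1
  -- `h3` concerns a section of the tangent bundle of ℝ along `f`; its fibre component is the
  -- function wanted.
  rw [contMDiffAt_totalSpace] at h3
  simpa [mvfderiv] using! h3.2

variable (h : AlmostHermitian E M)

lemma SmoothNear.form (hX : SmoothNear X p) (hY : SmoothNear Y p) :
    SmoothFunNear (E := E) (fun q ↦ h.g.form q (X q) (Y q)) p := by
  filter_upwards [hX, hY] with q h1 h2
  have := ContMDiffAt.clm_bundle_apply₂ (E₃ := fun _ : M ↦ ℝ) (F₃ := ℝ) (b := id) (h.g.contMDiff q) h1 h2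
  simpa [contMDiffAt_section] using this

lemma SmoothNear.J (hX : SmoothNear X p) : SmoothNear (fun q ↦ h.J q (X q)) p := by
  filter_upwards [hX] with q h1
  exact ContMDiffAt.clm_bundle_apply (b := id) (h.contMDiff_J q) h1

variable {nabla : CovariantDerivative 𝓘(ℝ, E) E (TangentSpace 𝓘(ℝ, E) : M → Type _)}

lemma SmoothNear.cov (hn : ∀ U : Set M, IsOpen U → ContMDiffCovariantDerivativeOn E ∞ nabla U)
    (hX : SmoothNear X p) (hY : SmoothNear Y p) :
    SmoothNear (fun q ↦ nabla Y q (X q)) p := by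
  obtain ⟨U, hU, hUo, hpU⟩ := eventually_nhds_iff.1 (hX.and hY)
  have := (hn U hUo).contMDiff (σ := Y) (fun q hq ↦ (hU q hq).2.contMDiffWithinAt)
  filter_upwards [hUo.mem_nhds hpU] with q hq
  exact ContMDiffAt.clm_bundle_apply (b := id) (this.contMDiffAt (hUo.mem_nhds hq)) (hU q hq).1

end Smooth

/-! ### Lie brackets and iterated derivatives of functions -/

section Bracket

set_option linter.unusedSectionVars false

open VectorField

variable {E : Type*} [NormedAddCommGroup E] [NormedSpace ℝ E] [FiniteDimensional ℝ E]
  {M : Type*} [TopologicalSpace M] [ChartedSpace E M] [IsManifold 𝓘(ℝ, E) ∞ M]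
  {X Y Z : Π q : M, TangentSpace 𝓘(ℝ, E) q} {f : M → ℝ} {p : M}

lemma SmoothNear.bracket (hX : SmoothNear X p) (hY : SmoothNear Y p) :
    SmoothNear (mlieBracket 𝓘(ℝ, E) X Y) p := by
  have : CompleteSpace E := FiniteDimensional.complete ℝ E
  filter_upwards [hX, hY] with q h1 h2
  have : IsManifold 𝓘(ℝ, E) ((⊤ : ℕ∞) + 1) M := ‹_›
  have : IsManifold 𝓘(ℝ, E) (minSmoothness ℝ 2) M :=
    IsManifold.of_le (n := ∞) (by simpa using ENat.LEInfty.out (m := 2))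
  exact ContMDiffAt.mlieBracket_vectorField (m := ⊤) (n := ⊤) h1 h2 (by simp)

lemma bracket_smul_eventually (hf : SmoothFunNear (E := E) f p) (hZ : SmoothNear Z p)
    (X : Π q : M, TangentSpace 𝓘(ℝ, E) q) :
    ∀ᶠ q in 𝓝 p, mlieBracket 𝓘(ℝ, E) X (f • Z) q =
      ((fun q ↦ mvfderiv 𝓘(ℝ, E) f q (X q)) • Z + f • mlieBracket 𝓘(ℝ, E) X Z) q := by
  have : CompleteSpace E := FiniteDimensional.complete ℝ E
  have : IsManifold 𝓘(ℝ, E) 2 M := IsManifold.of_le (n := ∞) (ENat.LEInfty.out (m := 2))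
  filter_upwards [hf.near, hZ.near] with q h1 h2
  exact mlieBracket_smul_right h1.diff h2.diff

/-- The Leibniz rule used twice. The two middle terms are symmetric in X and Y, so they drop out of
the Jacobi identity. -/
lemma bracket_bracket_smul (hY : SmoothNear Y p)
    (hf : SmoothFunNear (E := E) f p) (hZ : SmoothNear Z p) :
    mlieBracket 𝓘(ℝ, E) X (mlieBracket 𝓘(ℝ, E) Y (f • Z)) p =
      mvfderiv 𝓘(ℝ, E) (fun q ↦ mvfderiv 𝓘(ℝ, E) f q (Y q)) p (X p) • Z p
        + mvfderiv 𝓘(ℝ, E) f p (Y p) • mlieBracket 𝓘(ℝ, E) X Z p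
        + mvfderiv 𝓘(ℝ, E) f p (X p) • mlieBracket 𝓘(ℝ, E) Y Z p
        + f p • mlieBracket 𝓘(ℝ, E) X (mlieBracket 𝓘(ℝ, E) Y Z) p := by
  have : CompleteSpace E := FiniteDimensional.complete ℝ E
  have : IsManifold 𝓘(ℝ, E) 2 M := IsManifold.of_le (n := ∞) (ENat.LEInfty.out (m := 2))
  have e := bracket_smul_eventually hf hZ Y
  have hYf := SmoothNear.mvfderiv hf hY
  have hYZ := hY.bracket hZ
  rw [Filter.EventuallyEq.mlieBracket_vectorField_eq (V₁ := X) (V := X) (W₁ := mlieBracket 𝓘(ℝ, E) Y (f • Z))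
      Filter.EventuallyEq.rfl e,
    mlieBracket_add_right (hYf.diff.smul_section hZ.diff) (hf.diff.smul_section hYZ.diff),
    mlieBracket_smul_right hYf.diff hZ.diff, mlieBracket_smul_right hf.diff hYZ.diff]
  module

/-- `X(Yf) - Y(Xf) = [X, Y]f`. -/
lemma mvfderiv_mvfderiv_sub (hX : SmoothNear X p) (hY : SmoothNear Y p)
    (hf : SmoothFunNear (E := E) f p) :
    mvfderiv 𝓘(ℝ, E) (fun q ↦ mvfderiv 𝓘(ℝ, E) f q (Y q)) p (X p) -
      mvfderiv 𝓘(ℝ, E) (fun q ↦ mvfderiv 𝓘(ℝ, E) f q (X q)) p (Y p) =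
      mvfderiv 𝓘(ℝ, E) f p (mlieBracket 𝓘(ℝ, E) X Y p) := by
  have : CompleteSpace E := FiniteDimensional.complete ℝ E
  have : IsManifold 𝓘(ℝ, E) 2 M := IsManifold.of_le (n := ∞) (ENat.LEInfty.out (m := 2))
  have : IsManifold 𝓘(ℝ, E) (minSmoothness ℝ 3) M :=
    IsManifold.of_le (n := ∞) (by simpa using ENat.LEInfty.out (m := 3))
  -- Compare the Jacobi identities for X, Y, fZ and for X, Y, Z: what remains is the claimed
  -- difference times Z(p). A field with Z(p) ≠ 0 exists unless the tangent space is zero, where the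
  -- claim is trivial.
  by_cases hE : ∃ z : TangentSpace 𝓘(ℝ, E) p, z ≠ 0
  · obtain ⟨z, hz⟩ := hE
    have hZ := SmoothNear.extend z
    set Z := FiberBundle.extend E z with hZdef
    have hZp : Z p = z := FiberBundle.extend_apply_self E z
    have hC {W : Π q : M, TangentSpace 𝓘(ℝ, E) q} (h : SmoothNear W p) :
        ContMDiffAt 𝓘(ℝ, E) (𝓘(ℝ, E).prod 𝓘(ℝ, E)) (minSmoothness ℝ 2)
          (fun q ↦ (TotalSpace.mk' E q (W q) : TangentBundle 𝓘(ℝ, E) M)) p :=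
      ContMDiffAt.of_le h.smooth (by simpa using ENat.LEInfty.out (m := 2))
    have e1 := leibniz_identity_mlieBracket_apply (hC hX) (hC hY) (hC (hZ.smul hf))
    have e2 := leibniz_identity_mlieBracket_apply (hC hX) (hC hY) (hC hZ)
    rw [bracket_bracket_smul (X := X) hY hf hZ, bracket_bracket_smul (X := Y) hX hf hZ,
      mlieBracket_smul_right hf.diff hZ.diff, e2, hZp] at e1
    have e3 : (mvfderiv 𝓘(ℝ, E) (fun q ↦ mvfderiv 𝓘(ℝ, E) f q (Y q)) p (X p) -
      mvfderiv 𝓘(ℝ, E) (fun q ↦ mvfderiv 𝓘(ℝ, E) f q (X q)) p (Y p) -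
      mvfderiv 𝓘(ℝ, E) f p (mlieBracket 𝓘(ℝ, E) X Y p)) • z = 0 := by
      rw [← sub_eq_zero] at e1
      rw [← e1]
      module
    have := (smul_eq_zero.1 e3).resolve_right hz
    linarith
  · push Not at hE
    simp [hE (X p), hE (Y p), hE (mlieBracket 𝓘(ℝ, E) X Y p)]

end Bracket

/-! ### Tensoriality -/

section Curvature

set_option linter.unusedSectionVars false

open VectorField

variable {E : Type*} [NormedAddCommGroup E] [NormedSpace ℝ E] [FiniteDimensional ℝ E]
  {M : Type*} [TopologicalSpace M] [ChartedSpace E M] [IsManifold 𝓘(ℝ, E) ∞ M]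
  {X Y Z W X' Y' Z' : Π q : M, TangentSpace 𝓘(ℝ, E) q} {f : M → ℝ} {p : M}

/-- An operation on vector fields that is additive and `C^∞`-linear at `p` depends on the value of
the field at `p` only. -/
lemma eq_of_smooth_tensorial {A : Type*} [AddCommGroup A] [Module ℝ A]
    {Φ : (Π q : M, TangentSpace 𝓘(ℝ, E) q) → A}
    (smul : ∀ (f : M → ℝ) (X : Π q : M, TangentSpace 𝓘(ℝ, E) q), SmoothFunNear (E := E) f p →
      SmoothNear X p → Φ (f • X) = f p • Φ X)
    (add : ∀ X Y : Π q : M, TangentSpace 𝓘(ℝ, E) q, SmoothNear X p → SmoothNear Y p →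
      Φ (X + Y) = Φ X + Φ Y)
    (hX : SmoothNear X p) (hY : SmoothNear Y p) (hXY : X p = Y p) : Φ X = Φ Y := by
  classical
  have hlocal {X Y : Π q : M, TangentSpace 𝓘(ℝ, E) q} (hX : SmoothNear X p)
      (hY : SmoothNear Y p) (h : ∀ᶠ q in 𝓝 p, X q = Y q) : Φ X = Φ Y := by
    -- This indicator plays the role of a bump function: smoothness is needed only near p, where it
    -- is constantly 1, and ψX = ψY holds everywhere.
    let ψ (q : M) : ℝ := if X q = Y q then 1 else 0
    have hψp : ψ p = 1 := by simp [ψ, h.self_of_nhds]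
    have hψ : SmoothFunNear (E := E) ψ p := by
      filter_upwards [eventually_eventually_nhds.2 h] with q hq
      exact (contMDiffAt_const (c := (1 : ℝ))).congr_of_eventuallyEq
        (hq.mono fun r hr ↦ by simp [ψ, hr])
    have e : ψ • X = ψ • Y := by
      funext q
      by_cases hq : X q = Y q <;> simp [ψ, hq]
    simpa [hψp] using (smul ψ X hψ hX).symm.trans ((congrArg Φ e).trans (smul ψ Y hψ hY))
  have hzero : Φ 0 = 0 := by
    simpa using smul (fun _ ↦ 0) 0 (smoothFunNear_const 0) smoothNear_zero
  have hsum {ι : Type _} (s : Finset ι) (V : ι → Π q : M, TangentSpace 𝓘(ℝ, E) q)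
      (hV : ∀ i, SmoothNear (V i) p) : Φ (fun q ↦ ∑ i ∈ s, V i q) = ∑ i ∈ s, Φ (V i) := by
    induction s using Finset.induction_on with
    | empty => simpa using! hzero
    | insert a s ha ih =>
      simp only [Finset.sum_insert ha, ← ih]
      exact add _ _ (hV a) (SmoothNear.sum fun i _ ↦ hV i)
  let t := trivializationAt E (TangentSpace 𝓘(ℝ, E) : M → Type _) p
  have hp : p ∈ t.baseSet := FiberBundle.mem_baseSet_trivializationAt' p
  have htn : ∀ᶠ q in 𝓝 p, q ∈ t.baseSet := t.open_baseSet.mem_nhds hp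
  let b := Module.Basis.ofVectorSpace ℝ E
  let s := t.localFrame b
  let c := t.localFrameCoeff 𝓘(ℝ, E) b
  have hs (i) : SmoothNear (s i) p := by
    filter_upwards [htn] with q hq
    exact contMDiffAt_localFrame_of_mem ∞ _ b i hq
  have hc {X : Π q : M, TangentSpace 𝓘(ℝ, E) q} (hX : SmoothNear X p) (i) :
      SmoothFunNear (E := E) (LinearMap.piApply (c i) X) p := by
    filter_upwards [htn, hX] with q hq hX
    exact contMDiffAt_localFrameCoeff b hq hX i
  -- Expansion in a local frame: only the coefficients at p survive.
  have key {X : Π q : M, TangentSpace 𝓘(ℝ, E) q} (hX : SmoothNear X p) :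
      Φ X = ∑ i, c i p (X p) • Φ (s i) := by
    rw [hlocal hX (SmoothNear.sum fun i _ ↦ (hs i).smul (hc hX i))
      (t.eventually_eq_localFrame_sum_coeff_smul b hp),
      hsum _ (fun i ↦ (LinearMap.piApply (c i) X) • s i) (fun i ↦ (hs i).smul (hc hX i))]
    exact Finset.sum_congr rfl fun i _ ↦ smul _ _ (hc hX i) (hs i)
  rw [key hX, key hY, hXY]

end Curvature

/-! ### Symmetries of the curvature tensor -/

section CurvatureTensor

set_option linter.unusedSectionVars false

open VectorField

variable {E : Type*} [NormedAddCommGroup E] [NormedSpace ℝ E] [FiniteDimensional ℝ E]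
  {M : Type*} [TopologicalSpace M] [ChartedSpace E M] [IsManifold 𝓘(ℝ, E) ∞ M]
  {X Y Z W X' Y' Z' : Π q : M, TangentSpace 𝓘(ℝ, E) q} {f : M → ℝ} {p : M}
  {nabla : CovariantDerivative 𝓘(ℝ, E) E (TangentSpace 𝓘(ℝ, E) : M → Type _)}
  {h : AlmostHermitian E M}

lemma cov_add (hY : SmoothNear Y p) (hZ : SmoothNear Z p) :
    nabla (Y + Z) p = nabla Y p + nabla Z p :=
  nabla.isCovariantDerivativeOnUniv.add hY.diff hZ.diff

lemma cov_smul (hf : SmoothFunNear (E := E) f p) (hZ : SmoothNear Z p)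
    (v : TangentSpace 𝓘(ℝ, E) p) :
    nabla (f • Z) p v = f p • nabla Z p v + mvfderiv 𝓘(ℝ, E) f p v • Z p := by
  rw [nabla.isCovariantDerivativeOnUniv.leibniz hZ.diff hf.diff]
  simp

lemma cov_congr (hY : SmoothNear Y p) (e : ∀ᶠ q in 𝓝 p, Z q = Y q) :
    nabla Z p = nabla Y p :=
  nabla.isCovariantDerivativeOnUniv.congr_of_eventuallyEq (hY.congr e).diff hY.diff
    Filter.univ_mem e

variable (nabla) in
/-- `∇_X ∇_Y Z - ∇_Y ∇_X Z - ∇_{[X, Y]} Z` at `p`. -/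
def curvatureOp (X Y Z : Π q : M, TangentSpace 𝓘(ℝ, E) q) (p : M) : TangentSpace 𝓘(ℝ, E) p :=
  nabla (fun q ↦ nabla Z q (Y q)) p (X p) - nabla (fun q ↦ nabla Z q (X q)) p (Y p)
    - nabla Z p (mlieBracket 𝓘(ℝ, E) X Y p)

lemma curvatureOp_swap (X Y Z : Π q : M, TangentSpace 𝓘(ℝ, E) q) (p : M) :
    curvatureOp nabla X Y Z p = -curvatureOp nabla Y X Z p := by
  have : CompleteSpace E := FiniteDimensional.complete ℝ E
  rw [curvatureOp, curvatureOp, mlieBracket_swap_apply, map_neg]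
  module

lemma curvatureOp_add_right (hL : IsLeviCivita h.g nabla) (hX : SmoothNear X p)
    (hY : SmoothNear Y p) (hZ : SmoothNear Z p) (hW : SmoothNear W p) :
    curvatureOp nabla X Y (Z + W) p = curvatureOp nabla X Y Z p + curvatureOp nabla X Y W p := by
  have e (V : Π q : M, TangentSpace 𝓘(ℝ, E) q) : ∀ᶠ q in 𝓝 p, nabla (Z + W) q (V q) =
      ((fun q ↦ nabla Z q (V q)) + fun q ↦ nabla W q (V q)) q := by
    filter_upwards [hZ.near, hW.near] with q h1 h2
    simp [cov_add h1 h2]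
  have s {V U} (hV : SmoothNear V p) (hU : SmoothNear U p) := SmoothNear.cov hL.smooth hV hU
  rw [curvatureOp, cov_congr ((s hY hZ).add (s hY hW)) (e Y),
    cov_congr ((s hX hZ).add (s hX hW)) (e X), cov_add (s hY hZ) (s hY hW),
    cov_add (s hX hZ) (s hX hW), cov_add hZ hW, curvatureOp, curvatureOp]
  simp only [add_apply]
  module

/-- The first-order terms in f are symmetric in X and Y; the second-order ones combine to X(Yf) −
Y(Xf) − [X, Y]f = 0. -/
lemma curvatureOp_smul_right (hL : IsLeviCivita h.g nabla) (hX : SmoothNear X p)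
    (hY : SmoothNear Y p) (hf : SmoothFunNear (E := E) f p) (hZ : SmoothNear Z p) :
    curvatureOp nabla X Y (f • Z) p = f p • curvatureOp nabla X Y Z p := by
  have e (V : Π q : M, TangentSpace 𝓘(ℝ, E) q) : ∀ᶠ q in 𝓝 p, nabla (f • Z) q (V q) =
      (f • (fun q ↦ nabla Z q (V q)) + (fun q ↦ mvfderiv 𝓘(ℝ, E) f q (V q)) • Z) q := by
    filter_upwards [hZ.near, hf.near] with q h1 h2
    simp [cov_smul h2 h1]
  have s {V} (hV : SmoothNear V p) := SmoothNear.cov hL.smooth hV hZ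
  have d {V} (hV : SmoothNear V p) := SmoothNear.mvfderiv hf hV
  have k {V} (hV : SmoothNear V p) (v : TangentSpace 𝓘(ℝ, E) p) :
      nabla (fun q ↦ nabla (f • Z) q (V q)) p v = f p • nabla (fun q ↦ nabla Z q (V q)) p v
        + mvfderiv 𝓘(ℝ, E) f p v • nabla Z p (V p)
        + (mvfderiv 𝓘(ℝ, E) f p (V p) • nabla Z p v
        + mvfderiv 𝓘(ℝ, E) (fun q ↦ mvfderiv 𝓘(ℝ, E) f q (V q)) p v • Z p) := by
    rw [cov_congr (((s hV).smul hf).add (hZ.smul (d hV))) (e V),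
      cov_add ((s hV).smul hf) (hZ.smul (d hV)), add_apply, cov_smul hf (s hV),
      cov_smul (d hV) hZ]
  rw [curvatureOp, k hX, k hY, cov_smul hf hZ, ← mvfderiv_mvfderiv_sub hX hY hf, curvatureOp]
  module

lemma curvatureOp_add_middle (hL : IsLeviCivita h.g nabla)
    (hY : SmoothNear Y p) (hW : SmoothNear W p) (hZ : SmoothNear Z p) :
    curvatureOp nabla X (Y + W) Z p = curvatureOp nabla X Y Z p + curvatureOp nabla X W Z p := by
  have : CompleteSpace E := FiniteDimensional.complete ℝ E
  have : IsManifold 𝓘(ℝ, E) 2 M := IsManifold.of_le (n := ∞) (ENat.LEInfty.out (m := 2))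
  have e : ∀ᶠ q in 𝓝 p, nabla Z q ((Y + W) q) =
      ((fun q ↦ nabla Z q (Y q)) + fun q ↦ nabla Z q (W q)) q :=
    Filter.Eventually.of_forall fun q ↦ by simp
  have s {V} (hV : SmoothNear V p) := SmoothNear.cov hL.smooth hV hZ
  rw [curvatureOp, cov_congr ((s hY).add (s hW)) e, cov_add (s hY) (s hW),
    mlieBracket_add_right hY.diff hW.diff, curvatureOp, curvatureOp]
  simp only [add_apply, map_add, Pi.add_apply]
  module

/-- The term (Xf)∇_Y Z from the Leibniz rule cancels against the one from [X, fY]. -/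
lemma curvatureOp_smul_middle (hL : IsLeviCivita h.g nabla)
    (hf : SmoothFunNear (E := E) f p) (hY : SmoothNear Y p) (hZ : SmoothNear Z p) :
    curvatureOp nabla X (f • Y) Z p = f p • curvatureOp nabla X Y Z p := by
  have : CompleteSpace E := FiniteDimensional.complete ℝ E
  have : IsManifold 𝓘(ℝ, E) 2 M := IsManifold.of_le (n := ∞) (ENat.LEInfty.out (m := 2))
  have e : ∀ᶠ q in 𝓝 p, nabla Z q ((f • Y) q) = (f • (fun q ↦ nabla Z q (Y q))) q :=
    Filter.Eventually.of_forall fun q ↦ by simp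
  have s := SmoothNear.cov hL.smooth hY hZ
  rw [curvatureOp, cov_congr (s.smul hf) e, cov_smul hf s, mlieBracket_smul_right hf.diff hY.diff,
    curvatureOp]
  simp only [map_add, map_smul, Pi.smul_apply']
  module

lemma curvatureOp_congr (hL : IsLeviCivita h.g nabla) (hX : SmoothNear X p) (hX' : SmoothNear X' p)
    (hY : SmoothNear Y p) (hY' : SmoothNear Y' p) (hZ : SmoothNear Z p) (hZ' : SmoothNear Z' p)
    (eX : X p = X' p) (eY : Y p = Y' p) (eZ : Z p = Z' p) :
    curvatureOp nabla X Y Z p = curvatureOp nabla X' Y' Z' p := by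
  have key {X Y Y' : Π q : M, TangentSpace 𝓘(ℝ, E) q} (hY : SmoothNear Y p)
      (hY' : SmoothNear Y' p) (eY : Y p = Y' p) :
      curvatureOp nabla X Y Z p = curvatureOp nabla X Y' Z p :=
    eq_of_smooth_tensorial (Φ := fun Y ↦ curvatureOp nabla X Y Z p)
      (fun _ _ hf hV ↦ curvatureOp_smul_middle hL hf hV hZ)
      (fun _ _ hV hW ↦ curvatureOp_add_middle hL hV hW hZ) hY hY' eY
  rw [key hY hY' eY, curvatureOp_swap, key hX hX' eX, ← curvatureOp_swap]
  exact eq_of_smooth_tensorial (Φ := fun Z ↦ curvatureOp nabla X' Y' Z p)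
    (fun _ _ hf hV ↦ curvatureOp_smul_right hL hX' hY' hf hV)
    (fun _ _ hV hW ↦ curvatureOp_add_right hL hX' hY' hV hW) hZ hZ' eZ

/-- Allows R to be computed with extensions adapted to the situation, such as JZ or fields tangent
to a surface, instead of those with constant coordinates. -/
lemma curvatureOp_eq (hL : IsLeviCivita h.g nabla) (hX : SmoothNear X p) (hY : SmoothNear Y p)
    (hZ : SmoothNear Z p) :
    curvatureOp nabla X Y Z p = curvature nabla p (X p) (Y p) (Z p) := by
  rw [curvatureOp_congr hL hX (SmoothNear.extend (X p)) hY (SmoothNear.extend (Y p)) hZ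
    (SmoothNear.extend (Z p)) (by simp) (by simp) (by simp)]
  simp [curvatureOp, curvature]

lemma curvature_swap (hL : IsLeviCivita h.g nabla) (x y z : TangentSpace 𝓘(ℝ, E) p) :
    curvature nabla p x y z = -curvature nabla p y x z := by
  have s (v : TangentSpace 𝓘(ℝ, E) p) := SmoothNear.extend v
  simpa [curvatureOp_eq hL (s _) (s _) (s _)] using
    curvatureOp_swap (nabla := nabla) (FiberBundle.extend E x) (FiberBundle.extend E y)
      (FiberBundle.extend E z) p

/-- Take JZ as the extension of Jz and move J out through each covariant derivative. -/
lemma curvature_J (hK : IsKaehler h nabla) (x y z : TangentSpace 𝓘(ℝ, E) p) :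
    curvature nabla p x y (h.J p z) = h.J p (curvature nabla p x y z) := by
  have hL := hK.leviCivita
  have s (v : TangentSpace 𝓘(ℝ, E) p) := SmoothNear.extend v
  have e (v : TangentSpace 𝓘(ℝ, E) p) : nabla (fun q ↦ nabla
      (fun q ↦ h.J q (FiberBundle.extend E z q)) q (FiberBundle.extend E v q)) p =
      nabla (fun q ↦ h.J q (nabla (FiberBundle.extend E z) q (FiberBundle.extend E v q))) p := by
    refine cov_congr ((SmoothNear.cov hL.smooth (s v) (s z)).J h) ?_
    filter_upwards [(s z).near] with q hq
    exact hK.parallel_J _ _ hq.diff _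
  have := curvatureOp_eq hL (s x) (s y) ((s z).J h)
  have h2 := curvatureOp_eq hL (s x) (s y) (s z)
  simp only [FiberBundle.extend_apply_self] at this h2
  rw [← this, ← h2, curvatureOp, e, e,
    hK.parallel_J _ _ (SmoothNear.cov hL.smooth (s y) (s z)).diff,
    hK.parallel_J _ _ (SmoothNear.cov hL.smooth (s x) (s z)).diff,
    hK.parallel_J _ _ (s z).diff, curvatureOp, map_sub, map_sub]

/-- The first Bianchi identity. -/
lemma curvature_bianchi (hL : IsLeviCivita h.g nabla) (x y z : TangentSpace 𝓘(ℝ, E) p) :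
    curvature nabla p x y z + curvature nabla p y z x + curvature nabla p z x y = 0 := by
  have : CompleteSpace E := FiniteDimensional.complete ℝ E
  have : IsManifold 𝓘(ℝ, E) (minSmoothness ℝ 3) M :=
    IsManifold.of_le (n := ∞) (by simpa using ENat.LEInfty.out (m := 3))
  have s (v : TangentSpace 𝓘(ℝ, E) p) := SmoothNear.extend v
  have hC {W : Π q : M, TangentSpace 𝓘(ℝ, E) q} (h : SmoothNear W p) :
      ContMDiffAt 𝓘(ℝ, E) (𝓘(ℝ, E).prod 𝓘(ℝ, E)) (minSmoothness ℝ 2)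
        (fun q ↦ (TotalSpace.mk' E q (W q) : TangentBundle 𝓘(ℝ, E) M)) p :=
    ContMDiffAt.of_le h.smooth (by simpa using ENat.LEInfty.out (m := 2))
  -- Vanishing torsion used twice: ∇_W∇_U V − ∇_W∇_V U = ∇_W[U, V] = [W, [U, V]] + ∇_{[U, V]}W. The
  -- cyclic sum leaves only the Jacobi identity.
  have k (u v w : TangentSpace 𝓘(ℝ, E) p) :
      nabla (fun q ↦ nabla (FiberBundle.extend E v) q (FiberBundle.extend E u q)) p w
        - nabla (fun q ↦ nabla (FiberBundle.extend E u) q (FiberBundle.extend E v q)) p w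
      = mlieBracket 𝓘(ℝ, E) (FiberBundle.extend E w)
          (mlieBracket 𝓘(ℝ, E) (FiberBundle.extend E u) (FiberBundle.extend E v)) p
        + nabla (FiberBundle.extend E w) p
          (mlieBracket 𝓘(ℝ, E) (FiberBundle.extend E u) (FiberBundle.extend E v) p) := by
    have e : ∀ᶠ q in 𝓝 p, nabla (FiberBundle.extend E v) q (FiberBundle.extend E u q) =
        ((fun q ↦ nabla (FiberBundle.extend E u) q (FiberBundle.extend E v q)) +
          mlieBracket 𝓘(ℝ, E) (FiberBundle.extend E u) (FiberBundle.extend E v)) q := by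
      filter_upwards [(s u).near, (s v).near] with q h1 h2
      rw [Pi.add_apply, ← hL.torsion_free _ _ _ h1.diff h2.diff]
      module
    have b := (s u).bracket (s v)
    have t := hL.torsion_free _ _ _ (s w).diff b.diff
    rw [FiberBundle.extend_apply_self] at t
    rw [cov_congr ((SmoothNear.cov hL.smooth (s v) (s u)).add b) e,
      cov_add (SmoothNear.cov hL.smooth (s v) (s u)) b, add_apply, ← t]
    module
  have J := leibniz_identity_mlieBracket_apply (hC (s x)) (hC (s y)) (hC (s z))
  have l : mlieBracket 𝓘(ℝ, E) (FiberBundle.extend E y)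
      (mlieBracket 𝓘(ℝ, E) (FiberBundle.extend E x) (FiberBundle.extend E z)) p =
      - mlieBracket 𝓘(ℝ, E) (FiberBundle.extend E y)
      (mlieBracket 𝓘(ℝ, E) (FiberBundle.extend E z) (FiberBundle.extend E x)) p := by
    rw [mlieBracket_swap (V := FiberBundle.extend E x), ← neg_one_smul ℝ,
      mlieBracket_const_smul_right ((s z).bracket (s x)).diff, neg_one_smul]
  rw [mlieBracket_swap_apply (V := mlieBracket _ _ _), l, ← sub_eq_zero] at J
  have k1 := k x y z
  have k2 := k y z x
  have k3 := k z x y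
  simp only [curvature]
  linear_combination (norm := module) k1 + k2 + k3 + J

/-- Metric compatibility twice. The mixed terms are symmetric in X and Y, so antisymmetrizing leaves
only curvature and bracket terms. -/
lemma mvfderiv_mvfderiv_form (hL : IsLeviCivita h.g nabla)
    (hY : SmoothNear Y p) (hZ : SmoothNear Z p) (hW : SmoothNear W p) :
    mvfderiv 𝓘(ℝ, E) (fun q ↦ mvfderiv 𝓘(ℝ, E) (fun q ↦ h.g.form q (Z q) (W q)) q (Y q)) p (X p) =
      h.g.form p (nabla (fun q ↦ nabla Z q (Y q)) p (X p)) (W p)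
        + h.g.form p (nabla Z p (Y p)) (nabla W p (X p))
        + (h.g.form p (nabla Z p (X p)) (nabla W p (Y p))
        + h.g.form p (Z p) (nabla (fun q ↦ nabla W q (Y q)) p (X p))) := by
  have sZ := SmoothNear.cov hL.smooth hY hZ
  have sW := SmoothNear.cov hL.smooth hY hW
  have e : (fun q ↦ mvfderiv 𝓘(ℝ, E) (fun q ↦ h.g.form q (Z q) (W q)) q (Y q)) =ᶠ[𝓝 p]
      (fun q ↦ h.g.form q (nabla Z q (Y q)) (W q)) + fun q ↦ h.g.form q (Z q) (nabla W q (Y q)) := by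
    filter_upwards [hZ.near, hW.near] with q h1 h2
    exact hL.metric _ _ _ h1.diff h2.diff _
  have e2 : mvfderiv 𝓘(ℝ, E)
      (fun q ↦ mvfderiv 𝓘(ℝ, E) (fun q ↦ h.g.form q (Z q) (W q)) q (Y q)) p =
      mvfderiv 𝓘(ℝ, E) (fun q ↦ h.g.form q (nabla Z q (Y q)) (W q)) p +
      mvfderiv 𝓘(ℝ, E) (fun q ↦ h.g.form q (Z q) (nabla W q (Y q))) p := by
    have e3 : mvfderiv 𝓘(ℝ, E)
        (fun q ↦ mvfderiv 𝓘(ℝ, E) (fun q ↦ h.g.form q (Z q) (W q)) q (Y q)) p =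
        mvfderiv 𝓘(ℝ, E) ((fun q ↦ h.g.form q (nabla Z q (Y q)) (W q)) +
          fun q ↦ h.g.form q (Z q) (nabla W q (Y q))) p :=
      Filter.EventuallyEq.mfderiv_eq e
    rw [e3, mvfderiv_add (sZ.form h hW).diff (hZ.form h sW).diff]
  rw [e2, add_apply, hL.metric _ _ _ sZ.diff hW.diff, hL.metric _ _ _ hZ.diff sW.diff]

/-- This is X(Yf) − Y(Xf) = [X, Y]f for the function f = g(Z, U). -/
lemma curvatureTensor_swap_right (hL : IsLeviCivita h.g nabla) (x y z u : TangentSpace 𝓘(ℝ, E) p) :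
    curvatureTensor h.g nabla p x y z u = -curvatureTensor h.g nabla p x y u z := by
  have s (v : TangentSpace 𝓘(ℝ, E) p) := SmoothNear.extend v
  have k := mvfderiv_mvfderiv_sub (s x) (s y) ((s z).form h (s u))
  rw [mvfderiv_mvfderiv_form hL (s y) (s z) (s u),
    mvfderiv_mvfderiv_form hL (s x) (s z) (s u),
    hL.metric _ _ _ (s z).diff (s u).diff] at k
  simp only [FiberBundle.extend_apply_self] at k
  simp only [curvatureTensor, curvature, map_sub, sub_apply]
  rw [h.g.symm p _ z, h.g.symm p _ z, h.g.symm p _ z]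
  linarith

end CurvatureTensor

/-! ### Totally geodesic surfaces and isotropic vectors -/

section Surface

set_option linter.unusedSectionVars false

open VectorField

variable {E : Type*} [NormedAddCommGroup E] [NormedSpace ℝ E] [FiniteDimensional ℝ E]
  {M : Type*} [TopologicalSpace M] [ChartedSpace E M] [IsManifold 𝓘(ℝ, E) ∞ M]
  {N : Type*} [TopologicalSpace N] [ChartedSpace (EuclideanSpace ℝ (Fin 2)) N]
  [IsManifold (𝓡 2) ∞ N] {f : N → M} {a : N}
  {nabla : CovariantDerivative 𝓘(ℝ, E) E (TangentSpace 𝓘(ℝ, E) : M → Type _)}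
  {h : AlmostHermitian E M}

lemma mdifferentiable_of_mem_maximalAtlas {E : Type*} [NormedAddCommGroup E] [NormedSpace ℝ E]
    {M : Type*} [TopologicalSpace M] [ChartedSpace E M] [IsManifold 𝓘(ℝ, E) ∞ M]
    {e : OpenPartialHomeomorph M E} (he : e ∈ IsManifold.maximalAtlas 𝓘(ℝ, E) ∞ M) :
    e.MDifferentiable 𝓘(ℝ, E) 𝓘(ℝ, E) :=
  ⟨(contMDiffOn_of_mem_maximalAtlas he).mdifferentiableOn (by simp),
    (contMDiffOn_symm_of_mem_maximalAtlas he).mdifferentiableOn (by simp)⟩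

/-- A tangent vector of an immersed surface extends to a vector field of the ambient manifold that
is tangent to the surface. -/
lemma exists_tangent_extension (hf : Manifold.IsImmersionAt (𝓡 2) 𝓘(ℝ, E) ∞ f a)
    {v : TangentSpace 𝓘(ℝ, E) (f a)} (hv : v ∈ tangentPlane f a) :
    ∃ X : Π q : M, TangentSpace 𝓘(ℝ, E) q, SmoothNear X (f a) ∧ X (f a) = v ∧
      ∀ᶠ b in 𝓝 a, X (f b) ∈ tangentPlane f b := by
  have : CompleteSpace E := FiniteDimensional.complete ℝ E
  obtain ⟨w, rfl⟩ := hv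
  set φ := hf.domChart with hφ
  set ψ := hf.codChart with hψ
  have dφ := mdifferentiable_of_mem_maximalAtlas hf.domChart_mem_maximalAtlas
  have dψ := mdifferentiable_of_mem_maximalAtlas hf.codChart_mem_maximalAtlas
  -- In immersion charts f is this linear inclusion.
  let L : EuclideanSpace ℝ (Fin 2) →L[ℝ] E :=
    hf.equiv.toContinuousLinearMap ∘L ContinuousLinearMap.inl ℝ _ _
  have hfφ {b} (hb : b ∈ φ.source) : f b ∈ ψ.source := hf.source_subset_preimage_source hb
  have hmd {b} (hb : b ∈ φ.source) : MDifferentiableAt (𝓡 2) 𝓘(ℝ, E) f b :=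
    (hf.isImmersionAtOfComplement_complement.contMDiffOn.contMDiffAt
      (φ.open_source.mem_nhds hb)).mdifferentiableAt (by simp)
  have hchart {b} (hb : b ∈ φ.source) : ψ (f b) = L (φ b) := by
    have hb' : φ b ∈ (hf.domChart.extend (𝓡 2)).target := by
      simpa [← hφ] using φ.map_source hb
    have := hf.writtenInCharts hb'
    simpa [← hφ, ← hψ, L, φ.left_inv hb] using this
  have hder {b} (hb : b ∈ φ.source) (u : TangentSpace (𝓡 2) b) :
      mfderiv 𝓘(ℝ, E) 𝓘(ℝ, E) ψ (f b) (mfderiv (𝓡 2) 𝓘(ℝ, E) f b u) =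
        L (mfderiv (𝓡 2) (𝓡 2) φ b u) := by
    have h1 := ((dψ.mdifferentiableAt (hfφ hb)).hasMFDerivAt).comp b (hmd hb).hasMFDerivAt
    have h2 := (L.hasMFDerivAt (x := φ b)).comp b (dφ.mdifferentiableAt hb).hasMFDerivAt
    have h3 := h2.congr_of_eventuallyEq (f₁ := ψ ∘ f) (by
      filter_upwards [φ.open_source.mem_nhds hb] with c hc using hchart hc)
    exact congr($(hasMFDerivAt_unique h1 h3) u)
  have hinv {q} (hq : q ∈ ψ.source) (u : TangentSpace 𝓘(ℝ, E) q) :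
      (mfderiv 𝓘(ℝ, E) 𝓘(ℝ, E) ψ q).inverse (mfderiv 𝓘(ℝ, E) 𝓘(ℝ, E) ψ q u) = u := by
    have : mfderiv 𝓘(ℝ, E) 𝓘(ℝ, E) ψ q = (dψ.mfderiv hq).toContinuousLinearMap := rfl
    rw [this, ContinuousLinearMap.inverse_equiv]
    exact (dψ.mfderiv hq).symm_apply_apply u
  have ha : a ∈ φ.source := hf.mem_domChart_source
  -- The extension is the field constantly equal to c in the chart of M. As c lies in the range of
  -- L, the field is tangent to the surface at every nearby point of it.
  let c : E := L (mfderiv (𝓡 2) (𝓡 2) φ a w)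
  refine ⟨mpullback 𝓘(ℝ, E) 𝓘(ℝ, E) ψ (fun _ ↦ c), ?_, ?_, ?_⟩
  · filter_upwards [ψ.open_source.mem_nhds (hfφ ha)] with q hq
    refine ContMDiffAt.mpullback_vectorField_preimage (n := ∞) (m := ∞) ?_
      (contMDiffAt_of_mem_maximalAtlas hf.codChart_mem_maximalAtlas hq) ⟨dψ.mfderiv hq, rfl⟩
      (by simp)
    exact contMDiffAt_vectorSpace_iff_contDiffAt.2 contDiffAt_const
  · have := hinv (hfφ ha) (mfderiv (𝓡 2) 𝓘(ℝ, E) f a w)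
    rw [hder ha] at this
    exact this
  · filter_upwards [φ.open_source.mem_nhds ha] with b hb
    obtain ⟨u, hu⟩ := dφ.mfderiv_surjective hb (mfderiv (𝓡 2) (𝓡 2) φ a w)
    refine ⟨u, ?_⟩
    have := hinv (hfφ hb) (mfderiv (𝓡 2) 𝓘(ℝ, E) f b u)
    rw [hder hb, hu] at this
    exact this.symm

/-- The tangent planes of a totally geodesic surface are invariant under the curvature operator. -/
lemma curvature_mem_tangentPlane (hL : IsLeviCivita h.g nabla)
    (hf : Manifold.IsImmersion (𝓡 2) 𝓘(ℝ, E) ∞ f) (ht : IsTotallyGeodesic nabla f)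
    {x y z : TangentSpace 𝓘(ℝ, E) (f a)} (hx : x ∈ tangentPlane f a) (hy : y ∈ tangentPlane f a)
    (hz : z ∈ tangentPlane f a) : curvature nabla (f a) x y z ∈ tangentPlane f a := by
  obtain ⟨X, sX, rfl, tX⟩ := exists_tangent_extension (hf.isImmersionAt a) hx
  obtain ⟨Y, sY, rfl, tY⟩ := exists_tangent_extension (hf.isImmersionAt a) hy
  obtain ⟨Z, sZ, rfl, tZ⟩ := exists_tangent_extension (hf.isImmersionAt a) hz
  have hc : Filter.Tendsto f (𝓝 a) (𝓝 (f a)) := (hf.isImmersionAt a).contMDiffAt.continuousAt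
  -- Tangency is needed at all nearby points, so that the derivative can be differentiated again.
  have key {V W : Π q : M, TangentSpace 𝓘(ℝ, E) q} (sV : SmoothNear V (f a))
      (sW : SmoothNear W (f a)) (tV : ∀ᶠ b in 𝓝 a, V (f b) ∈ tangentPlane f b)
      (tW : ∀ᶠ b in 𝓝 a, W (f b) ∈ tangentPlane f b) :
      ∀ᶠ b in 𝓝 a, nabla W (f b) (V (f b)) ∈ tangentPlane f b := by
    filter_upwards [hc.eventually sV, hc.eventually sW, eventually_eventually_nhds.2 tV,
      eventually_eventually_nhds.2 tW] with b h1 h2 h3 h4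
    exact ht b V W h1 h2 h3 h4
  have sYZ := SmoothNear.cov hL.smooth sY sZ
  have sXZ := SmoothNear.cov hL.smooth sX sZ
  have sB := sX.bracket sY
  have tB : ∀ᶠ b in 𝓝 a, mlieBracket 𝓘(ℝ, E) X Y (f b) ∈ tangentPlane f b := by
    filter_upwards [key sX sY tX tY, key sY sX tY tX, hc.eventually sX, hc.eventually sY]
      with b h1 h2 h3 h4
    rw [← hL.torsion_free _ _ _ h3.diff h4.diff]
    exact Submodule.sub_mem _ h1 h2
  rw [← curvatureOp_eq hL sX sY sZ, curvatureOp]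
  exact Submodule.sub_mem _ (Submodule.sub_mem _ (key sX sYZ tX (key sY sZ tY tZ)).self_of_nhds
    (key sY sXZ tY (key sX sZ tX tZ)).self_of_nhds) (key sB sZ tB tZ).self_of_nhds

lemma form_self_J (h : AlmostHermitian E M) (p : M) (v : TangentSpace 𝓘(ℝ, E) p) :
    h.g.form p v (h.J p v) = 0 := by
  have h1 := h.compat p v (h.J p v)
  rw [h.J_sq, map_neg, h.g.symm] at h1
  linarith

lemma isIsotropicHolomorphicPlane_span (h : AlmostHermitian E M) (p : M)
    {v : TangentSpace 𝓘(ℝ, E) p} (hv : v ≠ 0) (hvv : h.g.form p v v = 0) :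
    IsIsotropicHolomorphicPlane h p (Submodule.span ℝ {v, h.J p v}) := by
  refine ⟨?_, ?_, v, Submodule.subset_span (by simp), hv, fun w hw ↦ ?_⟩
  · have hli : LinearIndependent ℝ ![v, h.J p v] := by
      rw [LinearIndependent.pair_iff]
      intro s t hst
      have h2 := congrArg (h.J p) hst
      simp only [map_add, map_smul, h.J_sq, map_zero] at h2
      -- Eliminates Jv between sv + tJv = 0 and its image sJv − tv = 0 under J.
      have h3 : (s ^ 2 + t ^ 2) • v = 0 := by
        linear_combination (norm := module) s • hst - t • h2
      have h4 := (smul_eq_zero.1 h3).resolve_right hv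
      constructor <;> nlinarith
    have := finrank_span_eq_card hli
    rwa [Matrix.range_cons_cons_empty, Fintype.card_fin] at this
  · rw [Submodule.map_span, Set.image_pair]
    apply le_antisymm <;> rw [Submodule.span_le, Set.insert_subset_iff, Set.singleton_subset_iff]
    · refine ⟨Submodule.subset_span (by simp), ?_⟩
      simp only [ContinuousLinearMap.coe_coe, h.J_sq]
      exact Submodule.neg_mem _ (Submodule.subset_span (by simp))
    · refine ⟨?_, Submodule.subset_span (by simp)⟩
      have : h.J p (h.J p v) ∈ Submodule.span ℝ {h.J p v, h.J p (h.J p v)} :=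
        Submodule.subset_span (by simp)
      rw [h.J_sq] at this
      simpa [h.J_sq] using this
  · obtain ⟨s, t, rfl⟩ := Submodule.mem_span_pair.1 hw
    simp [hvv, form_self_J]

/-- Under the axiom of isotropic holomorphic planes the holomorphic sectional curvature vanishes on
isotropic vectors. -/
lemma curvatureTensor_isotropic (hL : IsLeviCivita h.g nabla)
    (hax : AxiomOfIsotropicHolomorphicPlanes h nabla) (p : M) {v : TangentSpace 𝓘(ℝ, E) p}
    (hvv : h.g.form p v v = 0) :
    curvatureTensor h.g nabla p v (h.J p v) (h.J p v) v = 0 := by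
  by_cases hv : v = 0
  · simp [hv, curvatureTensor]
  obtain ⟨N, _, _, _, f, a, rfl, hf, -, hP, -, ht⟩ :=
    hax p _ (isIsotropicHolomorphicPlane_span h p hv hvv)
  have h4 : tangentPlane f a = Submodule.span ℝ {v, h.J (f a) v} := hP
  have h1 : v ∈ tangentPlane f a := h4 ▸ Submodule.subset_span (by simp)
  have h2 : h.J (f a) v ∈ tangentPlane f a := h4 ▸ Submodule.subset_span (by simp)
  -- R(v, Jv)Jv is a combination of v and Jv, both orthogonal to v.
  have h3 := curvature_mem_tangentPlane hL hf ht h1 h2 h2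
  rw [h4] at h3
  obtain ⟨s, t, hst⟩ := Submodule.mem_span_pair.1 h3
  rw [curvatureTensor, ← hst]
  simp [hvv, h.g.symm _ _ v, form_self_J]

end Surface

/-! ### Algebraic Kähler curvature tensors -/

section Algebra

variable {V : Type*} [AddCommGroup V] [Module ℝ V]

/-- `S` is a symmetric bilinear form. -/
structure IsSymmBilin (S : V → V → ℝ) : Prop where
  add_left (x y z : V) : S (x + y) z = S x z + S y z
  smul_left (c : ℝ) (x z : V) : S (c • x) z = c * S x z
  symm (x y : V) : S x y = S y x

namespace IsSymmBilin

variable {S : V → V → ℝ} (hS : IsSymmBilin S)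
include hS

lemma add_right (x y z : V) : S x (y + z) = S x y + S x z := by
  rw [hS.symm, hS.add_left, hS.symm y, hS.symm z]

lemma smul_right (c : ℝ) (x z : V) : S x (c • z) = c * S x z := by
  rw [hS.symm, hS.smul_left, hS.symm]

lemma neg_left (x z : V) : S (-x) z = -S x z := by
  rw [← neg_one_smul ℝ, hS.smul_left, neg_one_mul]

lemma neg_right (x z : V) : S x (-z) = -S x z := by
  rw [hS.symm, hS.neg_left, hS.symm]

/-- The linear form `S(·, z)`. -/
def toLin (z : V) : V →ₗ[ℝ] ℝ where
  toFun x := S x z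
  map_add' x y := hS.add_left x y z
  map_smul' c x := hS.smul_left c x z

end IsSymmBilin

/-- `S` is a symmetric bilinear form invariant under `J`. -/
structure IsHermitian (J : V →ₗ[ℝ] V) (S : V → V → ℝ) : Prop extends IsSymmBilin S where
  compat (x y : V) : S (J x) (J y) = S x y

namespace IsHermitian

variable {J : V →ₗ[ℝ] V} {S : V → V → ℝ} (hJ : ∀ v, J (J v) = -v) (hS : IsHermitian J S)
include hJ hS

lemma J_left (x y : V) : S (J x) y = -S x (J y) := by
  rw [← hS.compat x, hJ, hS.neg_right, neg_neg]

lemma self_J (x : V) : S x (J x) = 0 := by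
  have := hS.J_left hJ x x
  rw [hS.symm] at this
  linarith

end IsHermitian

/-- `T` has the algebraic symmetries of the curvature tensor of a Kähler manifold. -/
structure IsKaehlerTensor (J : V →ₗ[ℝ] V) (T : V → V → V → V → ℝ) : Prop where
  add₄ (x y z u w : V) : T x y z (u + w) = T x y z u + T x y z w
  smul₄ (c : ℝ) (x y z u : V) : T x y z (c • u) = c * T x y z u
  swap₁₂ (x y z u : V) : T x y z u = -T y x z u
  swap₃₄ (x y z u : V) : T x y z u = -T x y u z
  bianchi (x y z u : V) : T x y z u + T y z x u + T z x y u = 0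
  J₃₄ (x y z u : V) : T x y (J z) (J u) = T x y z u

namespace IsKaehlerTensor

variable {J : V →ₗ[ℝ] V} {T T' : V → V → V → V → ℝ} (hT : IsKaehlerTensor J T)
include hT

/-- The classical octahedron argument: four Bianchi identities combined with the two skew
symmetries. -/
lemma pair_swap (x y z u : V) : T x y z u = T z u x y := by
  linarith [hT.bianchi x y z u, hT.bianchi y z u x, hT.bianchi z u x y, hT.bianchi u x y z,
    hT.swap₁₂ x y z u, hT.swap₃₄ x y z u, hT.swap₁₂ z u x y, hT.swap₃₄ z u x y,
    hT.swap₃₄ y z x u, hT.swap₁₂ x u y z, hT.swap₃₄ x z u y, hT.swap₁₂ z x u y,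
    hT.swap₁₂ z x y u, hT.swap₃₄ z x y u, hT.swap₁₂ u y z x, hT.swap₃₄ u y z x,
    hT.swap₁₂ y u z x, hT.swap₃₄ y u z x, hT.swap₃₄ u x y z, hT.swap₃₄ x y u z]

lemma add₃ (x y z u w : V) : T x y (z + w) u = T x y z u + T x y w u := by
  rw [hT.swap₃₄, hT.add₄, hT.swap₃₄ x y z, hT.swap₃₄ x y w]; ring

lemma smul₃ (c : ℝ) (x y z u : V) : T x y (c • z) u = c * T x y z u := by
  rw [hT.swap₃₄, hT.smul₄, hT.swap₃₄ x y z]; ring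

lemma add₂ (x y z u w : V) : T x (y + w) z u = T x y z u + T x w z u := by
  rw [hT.pair_swap, hT.add₄, hT.pair_swap x y, hT.pair_swap x w]

lemma smul₂ (c : ℝ) (x y z u : V) : T x (c • y) z u = c * T x y z u := by
  rw [hT.pair_swap, hT.smul₄, hT.pair_swap x y]

lemma add₁ (x y z u w : V) : T (x + w) y z u = T x y z u + T w y z u := by
  rw [hT.pair_swap, hT.add₃, hT.pair_swap x y, hT.pair_swap w y]

lemma smul₁ (c : ℝ) (x y z u : V) : T (c • x) y z u = c * T x y z u := by
  rw [hT.pair_swap, hT.smul₃, hT.pair_swap x y]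

lemma J₁₂ (x y z u : V) : T (J x) (J y) z u = T x y z u := by
  rw [hT.pair_swap, hT.J₃₄, hT.pair_swap]

lemma neg₁ (x y z u : V) : T (-x) y z u = -T x y z u := by
  rw [← neg_one_smul ℝ, hT.smul₁, neg_one_mul]

lemma neg₄ (x y z u : V) : T x y z (-u) = -T x y z u := by
  rw [← neg_one_smul ℝ, hT.smul₄, neg_one_mul]

lemma sub (hT' : IsKaehlerTensor J T') :
    IsKaehlerTensor J (fun x y z u ↦ T x y z u - T' x y z u) where
  add₄ x y z u w := by rw [hT.add₄, hT'.add₄]; ring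
  smul₄ c x y z u := by rw [hT.smul₄, hT'.smul₄]; ring
  swap₁₂ x y z u := by rw [hT.swap₁₂, hT'.swap₁₂]; ring
  swap₃₄ x y z u := by rw [hT.swap₃₄, hT'.swap₃₄]; ring
  bianchi x y z u := by linarith [hT.bianchi x y z u, hT'.bianchi x y z u]
  J₃₄ x y z u := by rw [hT.J₃₄, hT'.J₃₄]

variable (hJ : ∀ v, J (J v) = -v)
include hJ

/-- With the next two lemmas, this identifies the terms that coincide when H is polarized. -/
lemma swap_J₁₂ (a b c d : V) : T a (J b) c d = T b (J a) c d := by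
  rw [hT.swap₁₂, ← hT.J₁₂, hJ, hT.neg₁, neg_neg]

lemma swap_J₃₄ (a b c d : V) : T a b (J c) d = T a b (J d) c := by
  rw [hT.pair_swap, hT.pair_swap a b, hT.swap₁₂, hT.swap_J₁₂ hJ, ← hT.swap₁₂]

lemma swap_J_pair (a b c d : V) : T a (J b) (J c) d = T c (J d) (J a) b := by
  rw [hT.pair_swap, hT.swap₁₂, hT.swap₃₄, neg_neg, hT.swap_J₁₂ hJ, hT.swap_J₃₄ hJ]

/-- A Kähler tensor is determined by its holomorphic sectional curvature. -/
lemma eq_zero_of_holomorphic (h0 : ∀ v, T v (J v) (J v) v = 0) (x y z u : V) : T x y z u = 0 := by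
  have sA := hT.swap_J₁₂ hJ
  have sB := hT.swap_J₃₄ hJ
  have sC := hT.swap_J_pair hJ
  -- Four values of the polynomial H(a + tb), whose end coefficients vanish, isolate its coefficient
  -- linear in t, which is 4T(a, Ja, Ja, b). `k2` and `k3` polarize further in a.
  have k1 (a b : V) : T a (J a) (J a) b = 0 := by
    have h1 := h0 (a + b)
    have h2 := h0 (a + (-1 : ℝ) • b)
    have h3 := h0 (a + (2 : ℝ) • b)
    have h4 := h0 (a + (-2 : ℝ) • b)
    simp only [map_add, map_smul, hT.add₁, hT.add₂, hT.add₃, hT.add₄, hT.smul₁, hT.smul₂, hT.smul₃,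
      hT.smul₄, h0] at h1 h2 h3 h4
    linarith [sB a (J a) a b, sC a a a b, sA a b (J a) a, sB b (J b) b a, sC b b b a, sA b a (J b) b]
  have k2 (a b c : V) : 2 * T a (J c) (J a) b + T a (J a) (J c) b = 0 := by
    have h1 := k1 (a + c) b
    have h2 := k1 (a + (-1 : ℝ) • c) b
    simp only [map_add, map_smul, hT.add₁, hT.add₂, hT.add₃, hT.smul₁, hT.smul₂, hT.smul₃,
      k1] at h1 h2
    linarith [sA a c (J a) b]
  have k3 (a b c d : V) :
      T a (J c) (J d) b + T d (J c) (J a) b + T a (J d) (J c) b = 0 := by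
    have h1 := k2 (a + d) b c
    simp only [map_add, hT.add₁, hT.add₂, hT.add₃] at h1
    linarith [k2 a b c, k2 d b c, sA a d (J c) b]
  -- Putting −Jy and −Jz into `k3` clears J from two of its three terms.
  have k4 (a y z d : V) : T a (J d) y (J z) = T a y z d + T a z y d := by
    have h1 := k3 a d (-J y) (-J z)
    have h2 := hT.J₃₄ a (J d) y (J z)
    simp only [map_neg, hJ, neg_neg, hT.neg₁, hT.neg₄] at h1 h2
    linarith [hT.J₁₂ (J z) y (J a) d, sC z y a d, hT.neg₁ z (J y) (J a) d,
      congrArg (fun w ↦ T w (J y) (J a) d) (hJ z), sB a (J d) z y]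
  have b' (x y z u : V) : T x y z u + T x z u y + T x u y z = 0 := by
    linarith [hT.pair_swap x y z u, hT.pair_swap x z u y, hT.pair_swap x u y z, hT.swap₁₂ z u x y,
      hT.swap₃₄ u z x y, hT.swap₁₂ u y x z, hT.swap₃₄ y u x z, hT.swap₁₂ y z x u,
      hT.swap₃₄ z y x u, hT.bianchi u z y x]
  -- Bianchi for Ju, y, Jz, rewritten by `k4`, and Bianchi for y, z, u give 4T(x, y, z, u) = 0.
  linarith [k4 x y z u, k4 x y u z, b' x (J u) y (J z), hT.J₃₄ x y z u, hT.swap₃₄ x (J z) y (J u),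
    hT.swap₃₄ x z y u, hT.swap₃₄ x y u z, b' x y z u]

end IsKaehlerTensor

end Algebra

/-! ### Division of a quartic by an indefinite quadratic form -/

section Quartic

/-- The identity theorem, used below for polynomials in s. -/
lemma eq_zero_of_analytic_of_gt {F : ℝ → ℝ} (hF : ∀ s, AnalyticAt ℝ F s) (s₀ : ℝ)
    (h0 : ∀ s, s₀ < s → F s = 0) (s : ℝ) : F s = 0 := by
  have h1 : F =ᶠ[nhds (s₀ + 1)] 0 := by
    filter_upwards [lt_mem_nhds (lt_add_one s₀)] with t ht using h0 t ht
  exact (AnalyticOnNhd.eqOn_zero_of_preconnected_of_eventuallyEq_zero (U := Set.univ)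
    (fun t _ ↦ hF t) isPreconnected_univ (Set.mem_univ _) h1) (Set.mem_univ s)

variable {V : Type*} [AddCommGroup V] [Module ℝ V] {J : V →ₗ[ℝ] V} {g : V → V → ℝ}
  {T : V → V → V → V → ℝ}

lemma IsKaehlerTensor.holomorphic_add (hT : IsKaehlerTensor J T) (hJ : ∀ v, J (J v) = -v)
    (t : ℝ) (e y : V) :
    T (t • e + y) (J (t • e + y)) (J (t • e + y)) (t • e + y) =
      t ^ 4 * T e (J e) (J e) e + t ^ 3 * (4 * T e (J e) (J e) y)
        + t ^ 2 * (2 * T e (J e) (J y) y + 4 * T e (J y) (J e) y) + t * (4 * T e (J y) (J y) y)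
        + T y (J y) (J y) y := by
  have sA := hT.swap_J₁₂ hJ
  have sB := hT.swap_J₃₄ hJ
  have sC := hT.swap_J_pair hJ
  simp only [map_add, map_smul, hT.add₁, hT.add₂, hT.add₃, hT.add₄, hT.smul₁, hT.smul₂, hT.smul₃,
    hT.smul₄]
  linear_combination t ^ 3 * (-sB e (J e) e y - sA e y (J e) e - 2 * sC e e e y)
    + t ^ 2 * (2 * sB e (J y) y e + sA y e (J e) y + sA y e (J y) e + sC y y e e)
    + t * (sA y e (J y) y + 2 * sC y y e y + sB y (J y) y e)

/-- Division by an indefinite quadratic form: the holomorphic sectional curvature of a Kähler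
tensor that vanishes on isotropic vectors is a multiple of the metric. -/
lemma IsKaehlerTensor.exists_factor (hT : IsKaehlerTensor J T) (hJ : ∀ v, J (J v) = -v)
    (hg : IsHermitian J g) {e y₀ : V} (he : g e e = -1) (hy₀ : g y₀ y₀ = 1) (hey : g e y₀ = 0)
    (h0 : ∀ v, g v v = 0 → T v (J v) (J v) v = 0) :
    ∃ S : V → V → ℝ, IsHermitian J S ∧ ∀ v, T v (J v) (J v) v = g v v * S v v := by
  set a₀ := T e (J e) (J e) e with ha₀
  -- For r = √g(y, y), both re + y and −re + y are isotropic; the odd and even parts in r of H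
  -- vanish separately.
  have hpos {y : V} (hy : g e y = 0) (hq : 0 < g y y) :
      T e (J e) (J e) y * g y y + T e (J y) (J y) y = 0 ∧
      a₀ * g y y ^ 2 + (2 * T e (J e) (J y) y + 4 * T e (J y) (J e) y) * g y y
        + T y (J y) (J y) y = 0 := by
    have hs := Real.sq_sqrt hq.le
    set r := Real.sqrt (g y y) with hr
    have hr0 : 0 < r := Real.sqrt_pos.2 hq
    have hnull (t : ℝ) (ht : t ^ 2 = g y y) : g (t • e + y) (t • e + y) = 0 := by
      simp only [hg.add_left, hg.add_right, hg.smul_left, hg.smul_right, he, hg.symm y e, hy]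
      linarith
    have h1 := h0 _ (hnull r hs)
    have h2 := h0 _ (hnull (-r) (by rw [neg_sq, hs]))
    rw [hT.holomorphic_add hJ] at h1 h2
    rw [← hs]
    constructor
    · have : r * (T e (J e) (J e) y * r ^ 2 + T e (J y) (J y) y) = 0 := by linarith
      exact (mul_eq_zero.1 this).resolve_left hr0.ne'
    · linarith
  -- Positivity of g(y, y) is removed by moving along y + s y₀, which stays orthogonal to e and has
  -- positive square for large s. The relations are polynomial in s, hence hold at s = 0.
  have key {y : V} (hy : g e y = 0) :
      T e (J e) (J e) y * g y y + T e (J y) (J y) y = 0 ∧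
      a₀ * g y y ^ 2 + (2 * T e (J e) (J y) y + 4 * T e (J y) (J e) y) * g y y
        + T y (J y) (J y) y = 0 := by
    have hs₀ (s : ℝ) (hs : 1 + |g y y| + 2 * |g y y₀| < s) :
        g e (y + s • y₀) = 0 ∧ 0 < g (y + s • y₀) (y + s • y₀) := by
      simp only [hg.add_left, hg.add_right, hg.smul_left, hg.smul_right, hg.symm y₀ y, hy, hy₀, hey]
      refine ⟨by ring, ?_⟩
      have := neg_abs_le (g y y)
      have := neg_abs_le (g y y₀)
      have := abs_nonneg (g y y)
      have := abs_nonneg (g y y₀)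
      have h1 : 1 < s := by linarith
      nlinarith
    constructor
    · have := eq_zero_of_analytic_of_gt
        (F := fun s : ℝ ↦ T e (J e) (J e) (y + s • y₀) * g (y + s • y₀) (y + s • y₀)
          + T e (J (y + s • y₀)) (J (y + s • y₀)) (y + s • y₀)) (fun s ↦ ?_) _
        (fun s hs ↦ (hpos (hs₀ s hs).1 (hs₀ s hs).2).1) 0
      · simpa using this
      · simp only [map_add, map_smul, hT.add₂, hT.add₃, hT.add₄, hT.smul₂, hT.smul₃, hT.smul₄, hg.add_left, hg.add_right, hg.smul_left, hg.smul_right]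
        fun_prop
    · have := eq_zero_of_analytic_of_gt
        (F := fun s : ℝ ↦ a₀ * g (y + s • y₀) (y + s • y₀) ^ 2
          + (2 * T e (J e) (J (y + s • y₀)) (y + s • y₀)
            + 4 * T e (J (y + s • y₀)) (J e) (y + s • y₀)) * g (y + s • y₀) (y + s • y₀)
          + T (y + s • y₀) (J (y + s • y₀)) (J (y + s • y₀)) (y + s • y₀)) (fun s ↦ ?_) _
        (fun s hs ↦ (hpos (hs₀ s hs).1 (hs₀ s hs).2).2) 0
      · simpa using this
      · simp only [map_add, map_smul, hT.add₁, hT.add₂, hT.add₃, hT.add₄, hT.smul₁, hT.smul₂,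
          hT.smul₃, hT.smul₄, hg.add_left, hg.add_right, hg.smul_left, hg.smul_right]
        fun_prop
  -- The projection onto the orthogonal complement of e; the sign is plus because g(e, e) = −1.
  let P : V →ₗ[ℝ] V := LinearMap.id + (hg.toLin e).smulRight e
  have hP (v : V) : P v = v + g v e • e := rfl
  -- Write v = te + y with y = Pv and q = g(y, y). The relations `key` turn H(v) into (t² − q)(a₀(t²
  -- + q) + 4tA + B), where A = T(e, Je, Je, y) and B is the t²-coefficient. As g(v, v) = q − t²,
  -- the quotient is minus the second factor, polarized here.
  let S₀ : V → V → ℝ := fun v w ↦ -(a₀ * (g v e * g w e + g (P v) (P w))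
    - 2 * (g w e * T e (J e) (J e) (P v) + g v e * T e (J e) (J e) (P w))
    + 2 * T e (J e) (J (P v)) (P w) + 4 * T e (J (P v)) (J e) (P w))
  have hS₀ : IsSymmBilin S₀ := by
    refine ⟨fun x y z ↦ ?_, fun c x z ↦ ?_, fun x y ↦ ?_⟩
    · simp only [S₀, map_add, hT.add₂, hT.add₃, hT.add₄, hg.add_left]
      ring
    · simp only [S₀, map_smul, hT.smul₂, hT.smul₃, hT.smul₄, hg.smul_left]
      ring
    · have h1 := hT.swap_J₃₄ hJ e (J e) (P x) (P y)
      have h2 := hT.swap_J_pair hJ e (P x) e (P y)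
      have h3 := hg.symm (P x) (P y)
      simp only [S₀]
      rw [h1, h2, h3]
      ring
  have hH (v : V) : T v (J v) (J v) v = g v v * S₀ v v := by
    have hv : v = (-g v e) • e + P v := by rw [hP]; module
    have hPe : g e (P v) = 0 := by
      rw [hP, hg.add_right, hg.smul_right, he, hg.symm]; ring
    obtain ⟨k1, k2⟩ := key hPe
    have hq : g v v = -(g v e) ^ 2 + g (P v) (P v) := by
      simp only [hP, hg.add_left, hg.add_right, hg.smul_left, hg.smul_right, he, hg.symm e v]
      ring
    have h1 := hT.holomorphic_add hJ (-g v e) e (P v)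
    rw [← hv] at h1
    rw [h1, hq]
    simp only [S₀]
    linear_combination (-4 * g v e) * k1 + k2
  -- Averaging over J keeps the factorization, since H and g are J-invariant.
  refine ⟨fun v w ↦ (S₀ v w + S₀ (J v) (J w)) / 2, ⟨⟨fun x y z ↦ ?_, fun c x z ↦ ?_,
    fun x y ↦ ?_⟩, fun x y ↦ ?_⟩, fun v ↦ ?_⟩
  · simp only [map_add, hS₀.add_left]; ring
  · simp only [map_smul, hS₀.smul_left]; ring
  · rw [hS₀.symm, hS₀.symm (J x)]
  · simp only [hJ, hS₀.neg_left, hS₀.neg_right]; ring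
  · have h1 := hH (J v)
    rw [hT.J₁₂, hT.J₃₄, hg.compat] at h1
    linarith [hH v]

end Quartic

/-! ### The tensors φ(S) + ψ(S) and their Bochner tensor -/

section BochnerAlgebra

variable {V : Type*} [AddCommGroup V] [Module ℝ V] {J : V →ₗ[ℝ] V} {g S : V → V → ℝ}
  {T : V → V → V → V → ℝ} {ι : Type*} [Fintype ι] {e : Module.Basis ι ℝ V}

/-- For Hermitian g and S, the forms g(·, J·) and S(·, J·) are skew, which makes the terms of φ and
ψ match up. -/
lemma isKaehlerTensor_phi_add_psi (hJ : ∀ v, J (J v) = -v) (hg : IsHermitian J g)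
    (hS : IsHermitian J S) :
    IsKaehlerTensor J (fun x y z u ↦ phi g S x y z u + psi g J S x y z u) where
  add₄ x y z u w := by
    simp only [phi, psi, map_add, hg.add_right, hS.add_right]; ring
  smul₄ c x y z u := by
    simp only [phi, psi, map_smul, hg.smul_right, hS.smul_right]; ring
  swap₁₂ x y z u := by
    have h1 : g y (J x) = -g x (J y) := by rw [hg.symm, hg.J_left hJ]
    have h2 : S y (J x) = -S x (J y) := by rw [hS.symm, hS.J_left hJ]
    simp only [phi, psi, h1, h2]; ring
  swap₃₄ x y z u := by
    have h1 : g u (J z) = -g z (J u) := by rw [hg.symm, hg.J_left hJ]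
    have h2 : S u (J z) = -S z (J u) := by rw [hS.symm, hS.J_left hJ]
    simp only [phi, psi, h1, h2]; ring
  bianchi x y z u := by
    have h1 (a b : V) : g a (J b) = -g b (J a) := by rw [hg.symm, hg.J_left hJ]
    have h2 (a b : V) : S a (J b) = -S b (J a) := by rw [hS.symm, hS.J_left hJ]
    simp only [phi, psi, h1 y x, h1 z x, h1 z y, h2 y x, h2 z x, h2 z y, hg.symm y x, hg.symm z x,
      hg.symm z y, hS.symm y x, hS.symm z x, hS.symm z y]
    ring
  J₃₄ x y z u := by
    simp only [phi, psi, hJ, hg.neg_right, hS.neg_right,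
      hg.J_left hJ z, hS.J_left hJ z]
    ring

lemma phi_add_psi_holomorphic (hJ : ∀ v, J (J v) = -v) (hg : IsHermitian J g)
    (hS : IsHermitian J S) (v : V) :
    phi g S v (J v) (J v) v + psi g J S v (J v) (J v) v = 8 * (g v v * S v v) := by
  simp only [phi, psi, hJ, hg.neg_right, hS.neg_right, hg.compat, hS.compat, hg.J_left hJ,
    hS.J_left hJ, hg.self_J hJ, hS.self_J hJ]
  ring

/-- Apply f to the expansion of a in the orthonormal basis; all contractions below reduce to this.
-/
lemma sum_orthonormal (hg : IsSymmBilin g) (h1 : ∀ i, g (e i) (e i) = 1 ∨ g (e i) (e i) = -1)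
    (h2 : ∀ i j, i ≠ j → g (e i) (e j) = 0) (f : V →ₗ[ℝ] ℝ) (a : V) :
    ∑ i, g (e i) (e i) * (g (e i) a * f (e i)) = f a := by
  have hr (i) : g (e i) a = g (e i) (e i) * e.repr a i := by
    have : g a (e i) = hg.toLin (e i) (∑ j, e.repr a j • e j) := by rw [e.sum_repr]; rfl
    rw [hg.symm, this, map_sum, Finset.sum_eq_single i]
    · simp [IsSymmBilin.toLin, mul_comm]
    · intro j _ hj
      simp [IsSymmBilin.toLin, h2 j i hj]
    · simp
  conv_rhs => rw [← e.sum_repr a, map_sum]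
  refine Finset.sum_congr rfl fun i _ ↦ ?_
  rw [hr i, map_smul, smul_eq_mul]
  rcases h1 i with h | h <;> rw [h] <;> ring

/-- The coefficient of S is 2n − 2 + 6: the trace of g and two contractions come from φ, and ψ
contributes six copies. -/
lemma ricci_phi_add_psi {n : ℕ} (hι : Fintype.card ι = 2 * n) (hJ : ∀ v, J (J v) = -v)
    (hg : IsHermitian J g) (hS : IsHermitian J S)
    (h1 : ∀ i, g (e i) (e i) = 1 ∨ g (e i) (e i) = -1)
    (h2 : ∀ i j, i ≠ j → g (e i) (e j) = 0) (y z : V) :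
    ricci g e (fun x y z u ↦ phi g S x y z u + psi g J S x y z u) y z =
      trace g e S * g y z + 2 * (n + 2) * S y z := by
  have k (f : V →ₗ[ℝ] ℝ) (a : V) := sum_orthonormal hg.toIsSymmBilin h1 h2 f a
  have hc : ∑ i, g (e i) (e i) * g (e i) (e i) = 2 * n := by
    rw [Finset.sum_congr rfl (fun i _ ↦ show g (e i) (e i) * g (e i) (e i) = 1 by
      rcases h1 i with h | h <;> rw [h] <;> ring)]
    simp [hι]
  have e1 (i) : g (e i) (e i) * (phi g S (e i) y z (e i) + psi g J S (e i) y z (e i)) =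
      g y z * (g (e i) (e i) * S (e i) (e i)) + S y z * (g (e i) (e i) * g (e i) (e i))
      - g (e i) (e i) * (g (e i) z * hS.toLin y (e i))
      - g (e i) (e i) * (g (e i) y * hS.toLin z (e i))
      + g (e i) (e i) * (g (e i) (J z) * hS.toLin (J y) (e i))
      + 2 * (g (e i) (e i) * (g (e i) (J y) * hS.toLin (J z) (e i)))
      + g (e i) (e i) * (g (e i) (J y) * hS.toLin (J z) (e i))
      + 2 * (g (e i) (e i) * (g (e i) (J z) * hS.toLin (J y) (e i))) := by
    have a1 (a : V) : S a (J (e i)) = - S (e i) (J a) := by rw [hS.symm, hS.J_left hJ]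
    have a2 (a : V) : g a (J (e i)) = - g (e i) (J a) := by rw [hg.symm, hg.J_left hJ]
    simp only [phi, psi, hg.self_J hJ, hS.self_J hJ, IsSymmBilin.toLin, LinearMap.coe_mk,
      AddHom.coe_mk, a1 y, a1 z, a2 y, a2 z, hg.symm y (e i), hS.symm y (e i)]
    ring
  simp only [ricci, e1, Finset.sum_add_distrib, Finset.sum_sub_distrib, ← Finset.mul_sum, k, hc]
  simp only [IsSymmBilin.toLin, LinearMap.coe_mk, AddHom.coe_mk, hS.compat, trace, hS.symm z y]
  ring

lemma trace_metric {n : ℕ} (hι : Fintype.card ι = 2 * n)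
    (h1 : ∀ i, g (e i) (e i) = 1 ∨ g (e i) (e i) = -1) : trace g e g = 2 * n := by
  rw [trace, Finset.sum_congr rfl (fun i _ ↦ show g (e i) (e i) * g (e i) (e i) = 1 by
    rcases h1 i with h | h <;> rw [h] <;> ring)]
  simp [hι]

/-- The Bochner tensor of `φ(S) + ψ(S)` vanishes for a Hermitian form `S`. -/
lemma bochner_phi_add_psi {n : ℕ} (hn : 1 ≤ n) (hι : Fintype.card ι = 2 * n)
    (hJ : ∀ v, J (J v) = -v) (hg : IsHermitian J g) (hS : IsHermitian J S)
    (h1 : ∀ i, g (e i) (e i) = 1 ∨ g (e i) (e i) = -1)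
    (h2 : ∀ i j, i ≠ j → g (e i) (e j) = 0) (x y z u : V) :
    bochner n g J e (fun x y z u ↦ phi g S x y z u + psi g J S x y z u) x y z u = 0 := by
  have hT := isKaehlerTensor_phi_add_psi hJ hg hS
  set T : V → V → V → V → ℝ := fun x y z u ↦ phi g S x y z u + psi g J S x y z u with hTdef
  have hρ (y z : V) : ricci g e T y z = trace g e S * g y z + 2 * (n + 2) * S y z :=
    ricci_phi_add_psi hι hJ hg hS h1 h2 y z
  have hbar (x y z u : V) : T (J x) (J y) (J z) (J u) = T x y z u := by rw [hT.J₃₄, hT.J₁₂]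
  have hstar : ricciStar g J e T = ricci g e T := by
    funext y z
    simp only [ricciStar, ricci, hT.J₃₄]
  have hP : ricci g e (fun x y z u ↦ T x y z u + T x y z u) = fun y z ↦ 2 * ricci g e T y z := by
    funext y z
    simp only [ricci, Finset.mul_sum]
    exact Finset.sum_congr rfl fun i _ ↦ by ring
  have hPs : ricciStar g J e (fun x y z u ↦ T x y z u + T x y z u) =
      fun y z ↦ 2 * ricci g e T y z := by
    rw [← hstar]
    funext y z
    simp only [ricciStar, Finset.mul_sum]
    exact Finset.sum_congr rfl fun i _ ↦ by ring
  have hτ : trace g e (ricci g e T) = 4 * (n + 1) * trace g e S := by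
    have h3 (i) : g (e i) (e i) * ricci g e T (e i) (e i) = trace g e S *
        (g (e i) (e i) * g (e i) (e i)) + 2 * (n + 2) * (g (e i) (e i) * S (e i) (e i)) := by
      rw [hρ]; ring
    have h4 : trace g e g = 2 * n := trace_metric hι h1
    calc trace g e (ricci g e T)
        = trace g e S * trace g e g + 2 * (n + 2) * trace g e S := by
          rw [trace, Finset.sum_congr rfl fun i _ ↦ h3 i, Finset.sum_add_distrib,
            ← Finset.mul_sum, ← Finset.mul_sum]
          rfl
      _ = 4 * (n + 1) * trace g e S := by rw [h4]; ring
  have hz : ricci g e (fun x y z u ↦ T x y z u - T x y z u) = fun _ _ ↦ 0 := by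
    funext y z; simp [ricci]
  have hzs : ricciStar g J e (fun x y z u ↦ T x y z u - T x y z u) = fun _ _ ↦ 0 := by
    funext y z; simp [ricciStar]
  -- As T is J-invariant, ρ* = ρ and T̄ = T, so the terms with denominators n − 1 and n − 2 have
  -- zero numerators. Of the rest, the (ρ + 3ρ*)-term equals (φ + ψ)(S) + tr S/(n + 2) · (π₁ + π₂),
  -- and the (τ + 3τ*)-term cancels its second summand.
  have hn2 : (n : ℝ) + 2 ≠ 0 := by positivity
  have hn1 : (n : ℝ) + 1 ≠ 0 := by positivity
  simp only [bochner, hbar, hP, hPs, hz, hzs, hstar, hτ, hρ]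
  simp only [hTdef, phi, psi, pi₁, pi₂]
  field_simp
  ring

/-- A Kähler tensor whose holomorphic sectional curvature vanishes on isotropic vectors has
vanishing Bochner tensor. -/
lemma IsKaehlerTensor.bochner_eq_zero (hT : IsKaehlerTensor J T) {n : ℕ} (hn : 1 ≤ n)
    (hι : Fintype.card ι = 2 * n) (hJ : ∀ v, J (J v) = -v) (hg : IsHermitian J g)
    (h1 : ∀ i, g (e i) (e i) = 1 ∨ g (e i) (e i) = -1)
    (h2 : ∀ i j, i ≠ j → g (e i) (e j) = 0) {a b : V} (ha : g a a = -1) (hb : g b b = 1)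
    (hab : g a b = 0) (h0 : ∀ v, g v v = 0 → T v (J v) (J v) v = 0) (x y z u : V) :
    bochner n g J e T x y z u = 0 := by
  obtain ⟨S, hS, hH⟩ := hT.exists_factor hJ hg ha hb hab h0
  -- The factor 8 is that of `phi_add_psi_holomorphic`.
  have hS' : IsHermitian J (fun x y ↦ S x y / 8) :=
    ⟨⟨fun x y z ↦ by rw [hS.add_left, add_div], fun c x z ↦ by rw [hS.smul_left, mul_div_assoc],
      fun x y ↦ by rw [hS.symm]⟩, fun x y ↦ by rw [hS.compat]⟩
  have hT' := isKaehlerTensor_phi_add_psi hJ hg hS'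
  have : T = fun x y z u ↦ phi g (fun x y ↦ S x y / 8) x y z u
      + psi g J (fun x y ↦ S x y / 8) x y z u := by
    funext x y z u
    rw [← sub_eq_zero]
    refine (hT.sub hT').eq_zero_of_holomorphic hJ (fun v ↦ ?_) x y z u
    rw [phi_add_psi_holomorphic hJ hg hS', hH]
    ring
  rw [this]
  exact bochner_phi_add_psi hn hι hJ hg hS' h1 h2 x y z u

end BochnerAlgebra

/-! ### From the Kähler manifold to the pointwise algebra -/

section Main

variable {E : Type*} [NormedAddCommGroup E] [NormedSpace ℝ E]
  {M : Type*} [TopologicalSpace M] [ChartedSpace E M] [IsManifold 𝓘(ℝ, E) ∞ M]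

lemma AlmostHermitian.isHermitian (h : AlmostHermitian E M) (p : M) :
    IsHermitian (h.J p).toLinearMap (fun v w ↦ h.g.form p v w) where
  add_left x y z := by simp
  smul_left c x z := by simp
  symm := h.g.symm p
  compat := h.compat p

/-- The curvature tensor of a Kähler manifold is a Kähler tensor at each point. -/
lemma IsKaehler.isKaehlerTensor_curvatureTensor [FiniteDimensional ℝ E] [T2Space M]
    {h : AlmostHermitian E M}
    {nabla : CovariantDerivative 𝓘(ℝ, E) E (TangentSpace 𝓘(ℝ, E) : M → Type _)}
    (hK : IsKaehler h nabla) (p : M) :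
    IsKaehlerTensor (h.J p).toLinearMap (curvatureTensor h.g nabla p) where
  add₄ x y z u w := by simp [curvatureTensor]
  smul₄ c x y z u := by simp [curvatureTensor]
  swap₁₂ x y z u := by simp [curvatureTensor, curvature_swap hK.leviCivita x y z]
  swap₃₄ x y z u := curvatureTensor_swap_right hK.leviCivita x y z u
  bianchi x y z u := by
    simpa [curvatureTensor] using
      congrArg (fun v ↦ h.g.form p v u) (curvature_bianchi hK.leviCivita x y z)
  J₃₄ x y z u := by
    simpa [curvatureTensor, curvature_J hK x y z] using h.compat p _ u

end Main

end IndefKaehler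

end

theorem theorem10 {E : Type*} [NormedAddCommGroup E] [NormedSpace ℝ E] [FiniteDimensional ℝ E]
    {M : Type*} [TopologicalSpace M] [T2Space M] [ChartedSpace E M] [IsManifold 𝓘(ℝ, E) ∞ M]
    (n s : ℕ) (hs : 2 ≤ s) (hns : 2 ≤ n - s)
    (h : IndefKaehler.AlmostHermitian E M)
    (hsig : h.g.HasSignature (2 * s) (2 * (n - s)))
    (nabla : CovariantDerivative 𝓘(ℝ, E) E (TangentSpace 𝓘(ℝ, E) : M → Type _))
    (hK : IndefKaehler.IsKaehler h nabla)
    (hax : IndefKaehler.AxiomOfIsotropicHolomorphicPlanes h nabla) :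
    IndefKaehler.BochnerVanishes n h nabla := by
  intro p e he x y z u
  obtain ⟨b, hb, hneg, hpos⟩ := hsig p
  -- The orthogonal pair of opposite signs needed for the division comes from the signature basis
  -- `b`; the traces use the given basis `e`.
  exact (hK.isKaehlerTensor_curvatureTensor p).bochner_eq_zero (by omega) (by simp) (h.J_sq p)
    (h.isHermitian p) he.1 he.2 (hneg ⟨0, by omega⟩) (hpos ⟨0, by omega⟩)
    (hb.2 _ _ Sum.inl_ne_inr)
    (fun v hv ↦ IndefKaehler.curvatureTensor_isotropic hK.leviCivita hax p hv) x y z u
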